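/- \textbf{Setting.} For probability measures $P_1,P_2$ on a metric space $(\mathcal X,d)$ and $p\in[1,\infty)$ let $W_p(P_1,P_2)=\inf\|d(X_1,X_2)\|_{L^p}\in[0,\infty]$, the infimum being over all couplings $(X_1,X_2)$ of $P_1$ and $P_2$. For two laws $\mathcal P_1,\mathcal P_2$ of random probability measures on $\mathbb R$ let $W_p^{(2)}(\mathcal P_1,\mathcal P_2)=\inf\|W_p(\Pi_1,\Pi_2)\|_{L^p}$, the infimum being over all couplings $(\Pi_1,\Pi_2)$ of $\mathcal P_1$ and $\mathcal P_2$. We write $P_\Pi$ for the law of $\Pi$, $\varepsilon_x$ for the Dirac mass at $x$, $\gamma_+=\max(\gamma,0)$ and $1/0=+\infty$; for $\gamma=0$, $\frac{x^\gamma-1}{\gamma}$ is read as $\log x$. For $\gamma\in\mathbb R$, $G_\gamma$ is the GEV law, with distribution function $\exp(-(1+\gamma x)^{-1/\gamma})$ for $1+\gamma x>0$, extended by $0$ to the left if $\gamma>0$ and by $1$ to the right if $\gamma<0$; $G_0(x)=\exp(-e^{-x})$. Let $F$ be a distribution function on $\mathbb R$ with quantile function $F^\leftarrow(u)=\inf\{x:F(x)\ge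 u\}$; put $U(t)=F^\leftarrow(1-1/t)$ for $t>1$ and $V(t)=F^\leftarrow(e^{-1/t})$ for $t>0$. Let $a:(0,\infty)\to(0,\infty)$. Let $X_1,X_2,\dots$ be i.i.d. with distribution function $F$, and for $1\le m\le n$ put $k=\lfloor n/m\rfloor$, \[ M_i=\max_{(i-1)m<j\le im}X_j,\qquad \Pi_{n,m}=\frac1k\sum_{i=1}^k\varepsilon_{(M_i-b_m)/a_m},\qquad a_m=a(m),\quad b_m=V(m). \] Let $\Pi_k^*=\frac1k\sum_{i=1}^k\varepsilon_{M_i^*}$ with $M_1^*,M_2^*,\dots$ i.i.d. with law $G_\gamma$. For $t>0$ let \[ A_p''(t)=\Big(\int_0^\infty\Big|\frac{V(tz)-V(t)}{a(t)}-\frac{z^\gamma-1}{\gamma}\Big|^pe^{-1/z}\frac{\mathrm dz}{z^2}\Big)^{1/p}\in[0,\infty]. \] \textbf{Theorem.} Let $\gamma<1$ and $p\in[1,1/\gamma_+)$. i) For every $m\ge1$, $W_p\big(P_{(M_1-b_m)/a_m},G_\gamma\big)=A_p''(m)$, and for all $1\le m\le n$, $W_p^{(2)}\big(P_{\Pi_{n,m}},P_{\Pi_k^*}\big)=A_p''(m)$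 (as equalities in $[0,\infty]$). ii) Suppose that $F$ has a finite left endpoint $\inf\{x:F(x)>0\}>-\infty$ and satisfies the first order condition \[ \lim_{t\to\infty}\frac{U(tx)-U(t)}{a(t)}=\frac{x^\gamma-1}{\gamma},\qquad x>0. \] If $m=m(n)\to\infty$, with $m(n)\le n$ for all large $n$, then $W_p^{(2)}\big(P_{\Pi_{n,m}},P_{\Pi_k^*}\big)\to0$ as $n\to\infty$. iii) Suppose furthermore that, for some $\rho\le0$ and some function $A$ that is eventually positive or eventually negative, regularly varying at infinity with index $\rho$ and such that $A(t)\to0$ as $t\to\infty$, the second order condition \[ \lim_{t\to\infty}\frac{\frac{V(tx)-V(t)}{a(t)}-\frac{x^\gamma-1}{\gamma}}{A(t)}=\Psi_{\gamma,\rho}(x):=\int_1^xs^{\gamma-1}\int_1^su^{\rho-1}\,\mathrm du\,\mathrm ds,\qquad x>0, \] holds. Then $c_p''(\gamma,\rho)=\Big(\int_0^\infty\Psi_{\gamma,\rho}(z)^pe^{-1/z}\frac{\mathrm dz}{z^2}\Big)^{1/p}$ is finite and, for $m=m(n)\to\infty$ with $m(n)\le n$ for all large $n$, the distance below is finite for all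 large $n$ and \[ W_p^{(2)}\big(P_{\Pi_{n,m}},P_{\Pi_k^*}\big)=c_p''(\gamma,\rho)\,|A(m)|\,(1+o(1)),\qquad n\to\infty. \] -/

import Mathlib

open MeasureTheory ProbabilityTheory Filter Topology Set Asymptotics
open scoped ENNReal

noncomputable section

namespace BlockMaxima

/-! ### Wasserstein distances -/

/-- `π` is (the joint law of) a coupling of `P₁` and `P₂`. -/
def IsCoupling {X : Type*} [MeasurableSpace X] (π : Measure (X × X)) (P₁ P₂ : Measure X) : Prop :=
  π.map Prod.fst = P₁ ∧ π.map Prod.snd = P₂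

/-- Transport distance of order `p ∈ [1, ∞)` for a distance `d`: the infimum of
`‖d(X₁, X₂)‖_{L^p}` over all couplings `(X₁, X₂)` of `P₁` and `P₂`, with values in `[0, ∞]`. -/
def transportDist {X : Type*} [MeasurableSpace X] (d : X → X → ℝ≥0∞) (p : ℝ)
    (P₁ P₂ : Measure X) : ℝ≥0∞ :=
  ⨅ (π : Measure (X × X)) (_ : IsCoupling π P₁ P₂), (∫⁻ z, d z.1 z.2 ^ p ∂π) ^ (1 / p)

/-- The Wasserstein distance `W_p` between probability measures on a metric space. -/
def wasserstein {X : Type*} [MeasurableSpace X] [PseudoEMetricSpace X] (p : ℝ)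
    (P₁ P₂ : Measure X) : ℝ≥0∞ :=
  transportDist (fun x y => edist x y) p P₁ P₂

/-- The second order Wasserstein distance `W_p^{(2)}` between laws of random probability measures:
the infimum of `‖W_p(Π₁, Π₂)‖_{L^p}` over all couplings of the two laws. A law of a random measure
is a measure on `Measure X`, whose σ-algebra is generated by the evaluations `Π ↦ Π B`; for Polish
`X` it induces on the space of probability measures of finite order `p` the Borel σ-algebra
of `W_p`. -/
def wasserstein₂ {X : Type*} [MeasurableSpace X] [PseudoEMetricSpace X] (p : ℝ)
    (L₁ L₂ : Measure (Measure X)) : ℝ≥0∞ :=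
  transportDist (wasserstein p) p L₁ L₂

/-- The empirical measure `(1/k) ∑_{i < k} ε_{x i}`. -/
def empiricalMeasure {X : Type*} [MeasurableSpace X] (k : ℕ) (x : ℕ → X) : Measure X :=
  (k : ℝ≥0∞)⁻¹ • ∑ i ∈ Finset.range k, Measure.dirac (x i)

/-! ### Extreme value distributions -/

/-- The function `(x ^ γ - 1) / γ`, read as `log x` when `γ = 0`. -/
def boxCox (γ x : ℝ) : ℝ := if γ = 0 then Real.log x else (x ^ γ - 1) / γ

/-- The GEV distribution function: `exp (-(1 + γ x) ^ (-1/γ))` where `1 + γ x > 0`, extended by `0`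
to the left (`γ > 0`) or by `1` to the right (`γ < 0`); `exp (-exp (-x))` for `γ = 0`. -/
def gevFun (γ x : ℝ) : ℝ :=
  if γ = 0 then Real.exp (-Real.exp (-x))
  else if 0 < 1 + γ * x then Real.exp (-(1 + γ * x) ^ (-1 / γ))
  else if γ < 0 then 1 else 0

theorem gevFun_mono (γ : ℝ) : Monotone (gevFun γ) := by
  intro x y hxy
  unfold gevFun
  by_cases h0 : γ = 0
  · simp only [h0, if_true]
    gcongr
  simp only [h0, if_false]
  rcases lt_or_gt_of_ne h0 with hneg | hpos
  · have hm : 1 + γ * y ≤ 1 + γ * x := by nlinarith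
    have he : 0 ≤ -1 / γ := div_nonneg_of_nonpos (by norm_num) hneg.le
    simp only [hneg, if_true]
    split_ifs with h1 h2 h2
    · gcongr
    · have := Real.rpow_nonneg h1.le (-1 / γ)
      exact Real.exp_le_one_iff.mpr (by linarith)
    · exact absurd (lt_of_lt_of_le h2 hm) h1
    · exact le_rfl
  · have hm : 1 + γ * x ≤ 1 + γ * y := by nlinarith
    have he : -1 / γ ≤ 0 := div_nonpos_of_nonpos_of_nonneg (by norm_num) hpos.le
    simp only [not_lt.mpr hpos.le, if_false]
    split_ifs with h1 h2 h2
    · have := Real.rpow_le_rpow_of_nonpos h1 hm he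
      exact Real.exp_le_exp.mpr (by linarith)
    · exact absurd (lt_of_lt_of_le h1 hm) h2
    · exact (Real.exp_pos _).le
    · exact le_rfl

theorem gevFun_continuous (γ : ℝ) : Continuous (gevFun γ) := by
  by_cases h0 : γ = 0
  · have : gevFun γ = fun x => Real.exp (-Real.exp (-x)) := by
      funext x; simp [gevFun, h0]
    rw [this]; fun_prop
  rcases lt_or_gt_of_ne h0 with hneg | hpos
  · have he : 0 < -1 / γ := div_pos_of_neg_of_neg (by norm_num) hneg
    have : gevFun γ = fun x => Real.exp (-(max 0 (1 + γ * x)) ^ (-1 / γ)) := by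
      funext x
      simp only [gevFun, h0, hneg, if_true, if_false]
      split_ifs with h
      · rw [max_eq_right h.le]
      · rw [max_eq_left (not_lt.mp h), Real.zero_rpow he.ne']; simp
    rw [this]
    have h1 : Continuous fun x : ℝ => (max 0 (1 + γ * x)) ^ (-1 / γ) :=
      Continuous.rpow_const (by fun_prop) (fun _ => Or.inr he.le)
    fun_prop
  · have he : -1 / γ < 0 := div_neg_of_neg_of_pos (by norm_num) hpos
    have key : Continuous fun t : ℝ => if 0 < t then Real.exp (-t ^ (-1 / γ)) else 0 := by
      rw [continuous_iff_continuousAt]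
      intro t
      rcases lt_trichotomy t 0 with ht | rfl | ht
      · refine (continuousAt_const (y := (0 : ℝ))).congr ?_
        filter_upwards [Iio_mem_nhds ht] with s hs
        rw [if_neg (not_lt.mpr (le_of_lt hs))]
      · rw [continuousAt_iff_continuous_left'_right']
        constructor
        · refine (continuousWithinAt_const (b := (0 : ℝ))).congr ?_ ?_
          · intro s hs
            rw [if_neg (not_lt.mpr (le_of_lt hs))]
          · simp
        · have hT : Tendsto (fun t : ℝ => t ^ (-1 / γ)) (𝓝[>] 0) atTop :=
            tendsto_rpow_neg_nhdsGT_zero he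
          have h2 := Real.tendsto_exp_atBot.comp (tendsto_neg_atTop_atBot.comp hT)
          simp only [ContinuousWithinAt, lt_irrefl, if_false]
          refine h2.congr' ?_
          filter_upwards [self_mem_nhdsWithin] with s hs
          have hs' : 0 < s := hs
          simp [hs']
      · have h3 : ContinuousAt (fun s : ℝ => Real.exp (-s ^ (-1 / γ))) t :=
          Real.continuous_exp.continuousAt.comp
            (Real.continuousAt_rpow_const t _ (Or.inl ht.ne')).neg
        refine h3.congr ?_
        filter_upwards [Ioi_mem_nhds ht] with s hs
        have hs' : 0 < s := hs
        simp [hs']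
    have : gevFun γ = (fun t : ℝ => if 0 < t then Real.exp (-t ^ (-1 / γ)) else 0) ∘
        fun x => 1 + γ * x := by
      funext x
      simp [gevFun, h0, not_lt.mpr hpos.le]
    rw [this]
    exact key.comp (by fun_prop)

theorem gevFun_tendsto_atBot (γ : ℝ) : Tendsto (gevFun γ) atBot (𝓝 0) := by
  by_cases h0 : γ = 0
  · have : gevFun γ = fun x => Real.exp (-Real.exp (-x)) := by
      funext x; simp [gevFun, h0]
    rw [this]
    exact Real.tendsto_exp_atBot.comp (tendsto_neg_atTop_atBot.comp
      (Real.tendsto_exp_atTop.comp tendsto_neg_atBot_atTop))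
  rcases lt_or_gt_of_ne h0 with hneg | hpos
  · have he : 0 < -1 / γ := div_pos_of_neg_of_neg (by norm_num) hneg
    have hlin : Tendsto (fun x : ℝ => 1 + γ * x) atBot atTop :=
      tendsto_atTop_add_const_left _ _ (tendsto_id.const_mul_atBot_of_neg hneg)
    have h2 := Real.tendsto_exp_atBot.comp (tendsto_neg_atTop_atBot.comp
      ((tendsto_rpow_atTop he).comp hlin))
    refine h2.congr' ?_
    filter_upwards [hlin.eventually_gt_atTop 0] with x hx
    simp [gevFun, h0, hx]
  · have hlin : Tendsto (fun x : ℝ => 1 + γ * x) atBot atBot :=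
      tendsto_atBot_add_const_left _ _ (tendsto_id.const_mul_atBot hpos)
    refine (tendsto_const_nhds (x := (0 : ℝ))).congr' ?_
    filter_upwards [hlin.eventually_lt_atBot 0] with x hx
    simp [gevFun, h0, not_lt.mpr hx.le, not_lt.mpr hpos.le]

theorem gevFun_tendsto_atTop (γ : ℝ) : Tendsto (gevFun γ) atTop (𝓝 1) := by
  by_cases h0 : γ = 0
  · have : gevFun γ = fun x => Real.exp (-Real.exp (-x)) := by
      funext x; simp [gevFun, h0]
    rw [this]
    have h1 : Tendsto (fun x : ℝ => -Real.exp (-x)) atTop (𝓝 0) := by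
      simpa using (Real.tendsto_exp_atBot.comp tendsto_neg_atTop_atBot).neg
    simpa [Function.comp_def] using (Real.continuous_exp.tendsto 0).comp h1
  rcases lt_or_gt_of_ne h0 with hneg | hpos
  · have hlin : Tendsto (fun x : ℝ => 1 + γ * x) atTop atBot :=
      tendsto_atBot_add_const_left _ _ (tendsto_id.const_mul_atTop_of_neg hneg)
    refine (tendsto_const_nhds (x := (1 : ℝ))).congr' ?_
    filter_upwards [hlin.eventually_lt_atBot 0] with x hx
    simp [gevFun, h0, not_lt.mpr hx.le, hneg]
  · have he : 0 < 1 / γ := by positivity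
    have hlin : Tendsto (fun x : ℝ => 1 + γ * x) atTop atTop :=
      tendsto_atTop_add_const_left _ _ (tendsto_id.const_mul_atTop hpos)
    have h1 : Tendsto (fun x : ℝ => -(1 + γ * x) ^ (-1 / γ)) atTop (𝓝 0) := by
      have := ((tendsto_rpow_neg_atTop he).comp hlin).neg
      simpa [neg_div, Function.comp_def] using this
    have h2 := (Real.continuous_exp.tendsto 0).comp h1
    rw [Real.exp_zero] at h2
    refine h2.congr' ?_
    filter_upwards [hlin.eventually_gt_atTop 0] with x hx
    simp [gevFun, h0, hx]

/-- The GEV distribution function as a Stieltjes function. -/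
def gevStieltjes (γ : ℝ) : StieltjesFunction ℝ where
  toFun := gevFun γ
  mono' := gevFun_mono γ
  right_continuous' _ := (gevFun_continuous γ).continuousWithinAt

/-- The GEV law `G_γ`: the probability measure on `ℝ` with distribution function `gevFun γ`. -/
def gev (γ : ℝ) : Measure ℝ := (gevStieltjes γ).measure

instance gev_isProbabilityMeasure (γ : ℝ) : IsProbabilityMeasure (gev γ) :=
  (gevStieltjes γ).isProbabilityMeasure (gevFun_tendsto_atBot γ) (gevFun_tendsto_atTop γ)

theorem cdf_gev (γ x : ℝ) : cdf (gev γ) x = gevFun γ x := by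
  have h := cdf_measure_stieltjesFunction (gevStieltjes γ) (gevFun_tendsto_atBot γ)
    (gevFun_tendsto_atTop γ)
  unfold gev
  rw [h]
  rfl

/-! ### Quantiles, first and second order conditions -/

/-- The quantile function `F^←(u) = inf {x | u ≤ F x}` (used for `0 < u < 1`). -/
def quantile (μ : Measure ℝ) (u : ℝ) : ℝ := sInf {x | u ≤ cdf μ x}

/-- The tail quantile function `U(t) = F^←(1 - 1/t)`, `t > 1`. -/
def tailU (μ : Measure ℝ) (t : ℝ) : ℝ := quantile μ (1 - 1 / t)

/-- The function `V(t) = F^←(exp (-1/t))`, `t > 0`. -/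
def tailV (μ : Measure ℝ) (t : ℝ) : ℝ := quantile μ (Real.exp (-1 / t))

/-- `F` has a finite left endpoint: `inf {x | F x > 0} > -∞`. -/
def FiniteLeftEndpoint (μ : Measure ℝ) : Prop := BddBelow {x | 0 < cdf μ x}

/-- The first order condition with index `γ` and normalizing function `a`. -/
def FirstOrderCondition (μ : Measure ℝ) (γ : ℝ) (a : ℝ → ℝ) : Prop :=
  ∀ x : ℝ, 0 < x →
    Tendsto (fun t => (tailU μ (t * x) - tailU μ t) / a t) atTop (𝓝 (boxCox γ x))

/-- `A`, of eventually constant sign, is regularly varying at infinity with index `ρ`. -/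
structure IsRegularlyVarying (A : ℝ → ℝ) (ρ : ℝ) : Prop where
  aemeasurable : AEMeasurable A (volume.restrict (Ioi 0))
  eventually_sign : (∀ᶠ t in atTop, 0 < A t) ∨ (∀ᶠ t in atTop, A t < 0)
  tendsto_ratio : ∀ x : ℝ, 0 < x → Tendsto (fun t => A (t * x) / A t) atTop (𝓝 (x ^ ρ))

/-- `Ψ_{γ,ρ}(x) = ∫_1^x s^{γ-1} ∫_1^s u^{ρ-1} du ds`. -/
def Psi (γ ρ x : ℝ) : ℝ := ∫ s in (1 : ℝ)..x, s ^ (γ - 1) * ∫ u in (1 : ℝ)..s, u ^ (ρ - 1)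

/-- The second order condition for `V`, with first order index `γ`, second order index `ρ ≤ 0` and
normalizing functions `a` and `A`. -/
structure SecondOrderCondition (μ : Measure ℝ) (γ : ℝ) (a : ℝ → ℝ) (ρ : ℝ) (A : ℝ → ℝ) :
    Prop where
  rho_nonpos : ρ ≤ 0
  regularlyVarying : IsRegularlyVarying A ρ
  tendsto_zero : Tendsto A atTop (𝓝 0)
  tendsto_quotient : ∀ x : ℝ, 0 < x →
    Tendsto (fun t => ((tailV μ (t * x) - tailV μ t) / a t - boxCox γ x) / A t) atTop
      (𝓝 (Psi γ ρ x))

/-! ### Block maxima -/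

/-- The maximum of the `i`-th block of size `m ≥ 1`; indices start at `0`. -/
def blockMax (m : ℕ) (x : ℕ → ℝ) (i : ℕ) : ℝ := ⨆ j : Fin m, x (i * m + j)

/-- The normalized `i`-th block maximum `(M_i - V(m)) / a(m)`. -/
def normBlockMax (μ : Measure ℝ) (a : ℝ → ℝ) (m : ℕ) (x : ℕ → ℝ) (i : ℕ) : ℝ :=
  (blockMax m x i - tailV μ m) / a m

/-- The law of the empirical measure of the `⌊n/m⌋` normalized maxima of blocks of size `m` of
`X_0, …, X_{n-1}`. -/
def lawEmpiricalMaxima {Ω : Type*} [MeasurableSpace Ω] (P : Measure Ω) (X : ℕ → Ω → ℝ)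
    (μ : Measure ℝ) (a : ℝ → ℝ) (n m : ℕ) : Measure (Measure ℝ) :=
  P.map fun ω => empiricalMeasure (n / m) (normBlockMax μ a m fun j => X j ω)

/-- The law of the empirical measure of `Y_0, …, Y_{k-1}`. -/
def lawEmpirical {Ω : Type*} [MeasurableSpace Ω] (P : Measure Ω) (Y : ℕ → Ω → ℝ)
    (k : ℕ) : Measure (Measure ℝ) :=
  P.map fun ω => empiricalMeasure k fun i => Y i ω

/-- `A''_p(t)`, the `L^p` norm of `(V(tz) - V(t)) / a(t) - (z^γ - 1) / γ` with respect to the unit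
Fréchet law `e^{-1/z} z^{-2} dz` on `(0, ∞)`; it may be infinite. -/
def approxRate (μ : Measure ℝ) (γ : ℝ) (a : ℝ → ℝ) (p t : ℝ) : ℝ≥0∞ :=
  (∫⁻ z in Ioi (0 : ℝ), ENNReal.ofReal
    (|(tailV μ (t * z) - tailV μ t) / a t - boxCox γ z| ^ p * (Real.exp (-1 / z) / z ^ 2)))
      ^ (1 / p)

/-- The integrand of the constant `c''_p(γ, ρ)`. -/
def limitIntegrand (γ ρ p z : ℝ) : ℝ := Psi γ ρ z ^ p * (Real.exp (-1 / z) / z ^ 2)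

/-- `c''_p(γ, ρ) = (∫_0^∞ Ψ_{γ,ρ}(z)^p e^{-1/z} dz / z²)^{1/p}`. -/
def limitConst (γ ρ p : ℝ) : ℝ := (∫ z in Ioi (0 : ℝ), limitIntegrand γ ρ p z) ^ (1 / p)

end BlockMaxima

end

noncomputable section

namespace BlockMaxima

/-! ### The transport cost on the line through distribution functions -/

/-! Exact formulas. Let Z be unit Fréchet. Since V(mz) ≤ x means exp(-1/z) ≤ F(x)^m, the normalized
block maximum has exactly the law of (V(mZ) - V(m))/a(m) (`maxLaw_map_eq`). In the same way `boxCox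
γ` of Z has law G_γ (`frechet_map_boxCox`). Both are nondecreasing functions of the same Z, and on
the line such a pair is an optimal coupling, so W_p is the L^p norm A''_p(m).

Optimality is proved through the functional `cdfCost`, built from distribution functions only. Every
coupling costs at least `cdfCost` (`cdfCost_le_lintegral`), and a monotone pair attains it
(`cdfCost_map_map`). The functional is also convex under mixing (`cdfCost_join_le`). This settles
the second order distance. For the upper bound, independent copies of Z are used and the atoms are
paired by index. For the lower bound, random measures are replaced by their means, and the mean of
an i.i.d. empirical measure is the common law (`join_map_tupleEmpirical`). The number of blocks thus
drops out.

Asymptotics. What remains is the behaviour of A''_p(t), obtained by dominated convergence against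
exp(-1/z) z^(-2) dz. A dominating function needs growth at most z^κ for z ≥ 1 with pκ < 1, and any
negative power of z for z ≤ 1, where the factor exp(-1/z) absorbs it. The growth bound iterates a
doubling inequality (`GrowthBound.of_doubling`) supplied by cocycle identities such as `incr_mul`.
The bound near 0 applies the same identities from the base point tz, and the finite left endpoint
once tz is no longer large (`incr_smallBound`, `remIncr_smallBound`).

The doubling argument starts from a bound on [1, 2]. At first order this follows from monotonicity
of V. At second order the remainder is not monotone, and a measure-theoretic pigeonhole
(`exists_good_point`) provides the bound (`rem_localBounds`). -/

theorem lintegral_Ioi_rpow_mul_ofReal_sub {p : ℝ} (hp : 1 < p) {r : ℝ} :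
    ∫⁻ w in Ioi (0 : ℝ), ENNReal.ofReal (p * (p - 1) * w ^ (p - 2)) * ENNReal.ofReal (r - w)
      = ENNReal.ofReal (max r 0 ^ p) := by
  rcases le_or_gt r 0 with hr | hr
  · rw [max_eq_right hr, Real.zero_rpow (by linarith), ENNReal.ofReal_zero]
    refine (setLIntegral_congr_fun measurableSet_Ioi fun w hw => ?_).trans lintegral_zero
    have : r - w ≤ 0 := by have := mem_Ioi.mp hw; linarith
    simp [ENNReal.ofReal_eq_zero.mpr this]
  rw [max_eq_left hr.le]
  have hp1 : 0 < p - 1 := by linarith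
  have hii1 : IntervalIntegrable (fun w : ℝ => w ^ (p - 2)) volume 0 r :=
    intervalIntegral.intervalIntegrable_rpow' (by linarith)
  have hii2 : IntervalIntegrable (fun w : ℝ => w ^ (p - 1)) volume 0 r :=
    intervalIntegral.intervalIntegrable_rpow' (by linarith)
  have hii : IntervalIntegrable
      (fun w : ℝ => p * (p - 1) * r * w ^ (p - 2) - p * (p - 1) * w ^ (p - 1)) volume 0 r :=
    (hii1.const_mul _).sub (hii2.const_mul _)
  have hval : ∫ w in (0 : ℝ)..r, (p * (p - 1) * r * w ^ (p - 2) - p * (p - 1) * w ^ (p - 1))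
      = r ^ p := by
    rw [intervalIntegral.integral_sub (hii1.const_mul _) (hii2.const_mul _),
      intervalIntegral.integral_const_mul, intervalIntegral.integral_const_mul,
      integral_rpow (Or.inl (by linarith)), integral_rpow (Or.inl (by linarith))]
    have e1 : p - 2 + 1 = p - 1 := by ring
    have e2 : p - 1 + 1 = p := by ring
    rw [e1, e2, Real.zero_rpow hp1.ne', Real.zero_rpow (by linarith)]
    have : r ^ p = r * r ^ (p - 1) := by
      rw [← Real.rpow_one_add' hr.le (by linarith)]; congr 1; ring
    rw [this]
    field_simp
    ring
  rw [← hval, intervalIntegral.integral_of_le hr.le, ofReal_integral_eq_lintegral_ofReal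
    ((intervalIntegrable_iff_integrableOn_Ioc_of_le hr.le).mp hii)]
  · rw [← Ioc_union_Ioi_eq_Ioi hr.le, lintegral_union measurableSet_Ioi Ioc_disjoint_Ioi_same]
    have h0 : ∫⁻ w in Ioi r, ENNReal.ofReal (p * (p - 1) * w ^ (p - 2)) * ENNReal.ofReal (r - w)
        = 0 := by
      refine (setLIntegral_congr_fun measurableSet_Ioi fun w hw => ?_).trans lintegral_zero
      have : r - w ≤ 0 := by have := mem_Ioi.mp hw; linarith
      simp [ENNReal.ofReal_eq_zero.mpr this]
    rw [h0, add_zero]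
    refine setLIntegral_congr_fun measurableSet_Ioc fun w hw => ?_
    have hw0 : 0 < w := hw.1
    rw [← ENNReal.ofReal_mul (by positivity)]
    congr 1
    have : w ^ (p - 1) = w * w ^ (p - 2) := by
      rw [← Real.rpow_one_add' hw0.le (by linarith)]; congr 1; ring
    rw [this]; ring
  · refine (ae_restrict_iff' measurableSet_Ioc).mpr (ae_of_all _ fun w hw => ?_)
    have hw0 : 0 < w := hw.1
    have : w ^ (p - 1) = w * w ^ (p - 2) := by
      rw [← Real.rpow_one_add' hw0.le (by linarith)]; congr 1; ring
    change 0 ≤ p * (p - 1) * r * w ^ (p - 2) - p * (p - 1) * w ^ (p - 1)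
    rw [this]
    have h2 : p * (p - 1) * r * w ^ (p - 2) - p * (p - 1) * (w * w ^ (p - 2))
      = p * (p - 1) * w ^ (p - 2) * (r - w) := by ring
    rw [h2]
    have := hw.2
    have : 0 ≤ r - w := by linarith
    positivity

/-- The measure `ν` on `[0, ∞)` with `r ^ p = ∫ (r - w)₊ ν(dw)` for `r ≥ 0`. -/
def kinkMeasure (p : ℝ) : Measure ℝ :=
  if p = 1 then Measure.dirac 0
  else (volume.restrict (Ioi 0)).withDensity fun w => ENNReal.ofReal (p * (p - 1) * w ^ (p - 2))

instance (p : ℝ) : SFinite (kinkMeasure p) := by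
  unfold kinkMeasure
  split_ifs <;> infer_instance

/-- For p > 1 this is Taylor's formula with integral remainder for r^p, whose value and first
derivative vanish at 0. For p = 1 the whole kink sits in the atom at 0. -/
theorem lintegral_kinkMeasure {p : ℝ} (hp : 1 ≤ p) (r : ℝ) :
    ∫⁻ w, ENNReal.ofReal (r - w) ∂kinkMeasure p = ENNReal.ofReal (max r 0 ^ p) := by
  unfold kinkMeasure
  split_ifs with h
  · subst h
    rw [lintegral_dirac' _ (by fun_prop), Real.rpow_one, sub_zero]
    rcases le_total r 0 with hr | hr
    · simp [hr]
    · simp [hr]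
  · rw [lintegral_withDensity_eq_lintegral_mul _ (by fun_prop) (by fun_prop)]
    exact lintegral_Ioi_rpow_mul_ofReal_sub (lt_of_le_of_ne hp (Ne.symm h))

theorem edist_rpow_eq_lintegral {p : ℝ} (hp : 1 ≤ p) (x y : ℝ) :
    edist x y ^ p = ∫⁻ w, (ENNReal.ofReal (y - x - w) + ENNReal.ofReal (x - y - w))
      ∂kinkMeasure p := by
  rw [lintegral_add_left (by fun_prop), lintegral_kinkMeasure hp, lintegral_kinkMeasure hp,
    edist_dist, Real.dist_eq, ENNReal.ofReal_rpow_of_nonneg (abs_nonneg _) (by linarith)]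
  have hp0 : p ≠ 0 := by linarith
  rcases le_total x y with h | h
  · rw [abs_of_nonpos (by linarith), max_eq_left (by linarith : 0 ≤ y - x),
      max_eq_right (by linarith : x - y ≤ 0), Real.zero_rpow hp0]
    simp
  · rw [abs_of_nonneg (by linarith), max_eq_right (by linarith : y - x ≤ 0),
      max_eq_left (by linarith : 0 ≤ x - y), Real.zero_rpow hp0]
    simp

theorem measurableSet_le_and_lt {α : Type*} [MeasurableSpace α] {f g h k : α → ℝ}
    (hf : Measurable f) (hg : Measurable g) (hh : Measurable h) (hk : Measurable k) :
    MeasurableSet {a | f a ≤ g a ∧ h a < k a} :=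
  (measurableSet_le hf hg).inter (measurableSet_lt hh hk)

/-- The positive part of y - x - w is the length of [x, y - w); Tonelli does the rest. -/
theorem lintegral_ofReal_sub_eq (π : Measure (ℝ × ℝ)) [SFinite π] (w : ℝ) :
    ∫⁻ z, ENNReal.ofReal (z.2 - z.1 - w) ∂π = ∫⁻ s, π {z | z.1 ≤ s ∧ s + w < z.2} := by
  have hm : MeasurableSet {q : (ℝ × ℝ) × ℝ | q.1.1 ≤ q.2 ∧ q.2 + w < q.1.2} :=
    measurableSet_le_and_lt (by fun_prop) (by fun_prop) (by fun_prop) (by fun_prop)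
  have h := lintegral_lintegral_swap (μ := π) (ν := (volume : Measure ℝ))
    (f := fun z s => indicator {q : (ℝ × ℝ) × ℝ | q.1.1 ≤ q.2 ∧ q.2 + w < q.1.2} 1 (z, s))
    ((measurable_const.indicator hm).aemeasurable)
  calc _ = ∫⁻ z, ∫⁻ s, indicator {q : (ℝ × ℝ) × ℝ | q.1.1 ≤ q.2 ∧ q.2 + w < q.1.2} 1 (z, s)
          ∂volume ∂π := by
        refine lintegral_congr fun z => ?_
        have : ∀ s, indicator {q : (ℝ × ℝ) × ℝ | q.1.1 ≤ q.2 ∧ q.2 + w < q.1.2}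
            (1 : (ℝ × ℝ) × ℝ → ℝ≥0∞) (z, s)
            = indicator (Ico z.1 (z.2 - w)) 1 s := by
          intro s
          simp only [indicator, mem_ofPred_eq, mem_Ico, lt_sub_iff_add_lt, Pi.one_apply]
        simp_rw [this]
        rw [lintegral_indicator_one measurableSet_Ico, Real.volume_Ico]
        congr 1; ring
    _ = _ := h
    _ = _ := by
        refine lintegral_congr fun s => ?_
        rw [← lintegral_indicator_one
          (measurableSet_le_and_lt (by fun_prop) (by fun_prop) (by fun_prop) (by fun_prop) :
            MeasurableSet {z : ℝ × ℝ | z.1 ≤ s ∧ s + w < z.2})]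
        rfl

theorem lintegral_edist_rpow_eq {p : ℝ} (hp : 1 ≤ p) (π : Measure (ℝ × ℝ)) [SFinite π] :
    ∫⁻ z, edist z.1 z.2 ^ p ∂π = ∫⁻ w, ∫⁻ s, (π {z | z.1 ≤ s ∧ s + w < z.2} +
      π {z | z.2 ≤ s ∧ s + w < z.1}) ∂volume ∂kinkMeasure p := by
  simp_rw [edist_rpow_eq_lintegral hp]
  rw [lintegral_lintegral_swap (by fun_prop)]
  refine lintegral_congr fun w => ?_
  have hm : Measurable fun s => π {z : ℝ × ℝ | z.1 ≤ s ∧ s + w < z.2} := by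
    have : MeasurableSet {q : ℝ × (ℝ × ℝ) | q.2.1 ≤ q.1 ∧ q.1 + w < q.2.2} :=
      measurableSet_le_and_lt (by fun_prop) (by fun_prop) (by fun_prop) (by fun_prop)
    exact measurable_measure_prodMk_left this
  rw [lintegral_add_left (by fun_prop), lintegral_add_left hm, lintegral_ofReal_sub_eq]
  congr 1
  have h := lintegral_ofReal_sub_eq (π.map Prod.swap) w
  rw [lintegral_map (by fun_prop) measurable_swap] at h
  rw [show (∫⁻ z, ENNReal.ofReal (z.1 - z.2 - w) ∂π)
    = ∫⁻ z, ENNReal.ofReal (z.swap.2 - z.swap.1 - w) ∂π from rfl, h]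
  refine lintegral_congr fun s => ?_
  rw [Measure.map_apply measurable_swap
    (measurableSet_le_and_lt (by fun_prop) (by fun_prop) (by fun_prop) (by fun_prop) :
      MeasurableSet {z : ℝ × ℝ | z.1 ≤ s ∧ s + w < z.2})]
  rfl

/-- The optimal transport cost of order `p` on the line, written with distribution functions. -/
def cdfCost (p : ℝ) (P₁ P₂ : Measure ℝ) : ℝ≥0∞ :=
  ∫⁻ w, ∫⁻ s, ((P₁ (Iic s) - P₂ (Iic (s + w))) + (P₂ (Iic s) - P₁ (Iic (s + w))))
    ∂volume ∂kinkMeasure p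

/-- If x ≤ s, then either y ≤ t or the pair lies in the set on the right. Subtraction in `ℝ≥0∞` is
truncated, so the left side is a positive part. -/
theorem measure_Iic_sub_le {π : Measure (ℝ × ℝ)} {P₁ P₂ : Measure ℝ} (h : IsCoupling π P₁ P₂)
    (s t : ℝ) : P₁ (Iic s) - P₂ (Iic t) ≤ π {z | z.1 ≤ s ∧ t < z.2} := by
  rw [tsub_le_iff_right, ← h.1, ← h.2, Measure.map_apply measurable_fst measurableSet_Iic,
    Measure.map_apply measurable_snd measurableSet_Iic]
  refine (measure_mono fun z hz => ?_).trans (measure_union_le _ _)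
  rcases le_or_gt z.2 t with h2 | h2
  · exact Or.inr h2
  · exact Or.inl ⟨hz, h2⟩

theorem IsCoupling.swap {X : Type*} [MeasurableSpace X] {π : Measure (X × X)} {P₁ P₂ : Measure X}
    (h : IsCoupling π P₁ P₂) : IsCoupling (π.map Prod.swap) P₂ P₁ := by
  constructor
  · rw [Measure.map_map measurable_fst measurable_swap, ← h.2]; rfl
  · rw [Measure.map_map measurable_snd measurable_swap, ← h.1]; rfl

theorem transportDist_le {X : Type*} [MeasurableSpace X] (d : X → X → ℝ≥0∞) (p : ℝ)
    {π : Measure (X × X)} {P₁ P₂ : Measure X} (h : IsCoupling π P₁ P₂) :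
    transportDist d p P₁ P₂ ≤ (∫⁻ z, d z.1 z.2 ^ p ∂π) ^ (1 / p) :=
  iInf₂_le π h

theorem cdfCost_le_lintegral {p : ℝ} (hp : 1 ≤ p) {π : Measure (ℝ × ℝ)} [SFinite π]
    {P₁ P₂ : Measure ℝ} (h : IsCoupling π P₁ P₂) :
    cdfCost p P₁ P₂ ≤ ∫⁻ z, edist z.1 z.2 ^ p ∂π := by
  rw [lintegral_edist_rpow_eq hp]
  refine lintegral_mono fun w => lintegral_mono fun s => add_le_add (measure_Iic_sub_le h _ _) ?_
  refine (measure_Iic_sub_le h.swap _ _).trans_eq ?_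
  rw [Measure.map_apply measurable_swap
    (measurableSet_le_and_lt (by fun_prop) (by fun_prop) (by fun_prop) (by fun_prop) :
      MeasurableSet {z : ℝ × ℝ | z.1 ≤ s ∧ s + w < z.2})]
  rfl

theorem cdfCost_le_wasserstein_rpow {p : ℝ} (hp : 1 ≤ p) {P₁ P₂ : Measure ℝ} [IsFiniteMeasure P₁] :
    cdfCost p P₁ P₂ ≤ wasserstein p P₁ P₂ ^ p := by
  have hp0 : 0 < p := by linarith
  rw [← ENNReal.rpow_inv_le_iff hp0]
  refine le_iInf₂ fun π hπ => ?_
  have : IsFiniteMeasure (π.map Prod.fst) := by rw [hπ.1]; infer_instance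
  have : IsFiniteMeasure π := Measure.isFiniteMeasure_of_map measurable_fst.aemeasurable
  rw [one_div]
  exact ENNReal.rpow_le_rpow (cdfCost_le_lintegral hp hπ) (by positivity)

/-- A monotone pair is an optimal coupling. -/
theorem cdfCost_map_map {p : ℝ} (hp : 1 ≤ p) {τ : Measure ℝ} [IsFiniteMeasure τ] {S : Set ℝ}
    (hS : ∀ᵐ z ∂τ, z ∈ S) {f g : ℝ → ℝ} (hf : Measurable f) (hg : Measurable g)
    (hfm : MonotoneOn f S) (hgm : MonotoneOn g S) :
    cdfCost p (τ.map f) (τ.map g) = ∫⁻ z, edist (f z) (g z) ^ p ∂τ := by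
  have key : ∀ {f g : ℝ → ℝ}, Measurable f → Measurable g → MonotoneOn f S → MonotoneOn g S →
      ∀ s t, τ.map f (Iic s) - τ.map g (Iic t) = τ {z | f z ≤ s ∧ t < g z} := by
    intro f g hf hg hfm hgm s t
    rw [Measure.map_apply hf measurableSet_Iic, Measure.map_apply hg measurableSet_Iic]
    have hB : MeasurableSet (g ⁻¹' Iic t) := hg measurableSet_Iic
    have hset : {z | f z ≤ s ∧ t < g z} = f ⁻¹' Iic s \ g ⁻¹' Iic t := by
      ext z; simp
    rw [hset]
    -- Sublevel sets of two monotone functions are nested on `S`. If this inclusion fails at z₀,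
    -- then f z ≤ s forces z ≤ z₀, hence g z ≤ t: the reverse inclusion holds and both sides vanish.
    by_cases hsub : g ⁻¹' Iic t ∩ S ⊆ f ⁻¹' Iic s
    · have hae : g ⁻¹' Iic t ≤ᵐ[τ] f ⁻¹' Iic s := by
        filter_upwards [hS] with z hz hzt using hsub ⟨hzt, hz⟩
      have h1 := measure_sdiff_add_inter (μ := τ) (f ⁻¹' Iic s) hB
      have h2 : τ (f ⁻¹' Iic s ∩ g ⁻¹' Iic t) = τ (g ⁻¹' Iic t) := by
        refine measure_congr ?_
        filter_upwards [hae] with z hz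
        exact propext ⟨fun h => h.2, fun h => ⟨hz h, h⟩⟩
      rw [← h1, h2, ENNReal.add_sub_cancel_right (measure_ne_top _ _)]
    · obtain ⟨z₀, ⟨hz₀t, hz₀⟩, hz₀s⟩ := not_subset.mp hsub
      have hz₀t : g z₀ ≤ t := hz₀t
      have hz₀s : s < f z₀ := not_le.mp hz₀s
      have hae : f ⁻¹' Iic s ≤ᵐ[τ] g ⁻¹' Iic t := by
        filter_upwards [hS] with z hz hzs
        have hzs : f z ≤ s := hzs
        have : z ≤ z₀ := by
          by_contra hc
          have := hfm hz₀ hz (le_of_not_ge hc)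
          linarith
        exact (hgm hz hz₀ this).trans hz₀t
      have h0 := measure_mono_ae hae
      rw [tsub_eq_zero_of_le h0]
      exact (ae_le_set.mp hae).symm
  rw [← lintegral_map (f := fun q : ℝ × ℝ => edist q.1 q.2 ^ p) (g := fun z => (f z, g z))
    (by fun_prop) (by fun_prop), lintegral_edist_rpow_eq hp]
  refine lintegral_congr fun w => lintegral_congr fun s => ?_
  rw [key hf hg hfm hgm, key hg hf hgm hfm]
  rw [Measure.map_apply (by fun_prop)
    (measurableSet_le_and_lt (by fun_prop) (by fun_prop) (by fun_prop) (by fun_prop) :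
      MeasurableSet {z : ℝ × ℝ | z.1 ≤ s ∧ s + w < z.2}),
    Measure.map_apply (by fun_prop)
      (measurableSet_le_and_lt (by fun_prop) (by fun_prop) (by fun_prop) (by fun_prop) :
      MeasurableSet {z : ℝ × ℝ | z.2 ≤ s ∧ s + w < z.1})]
  rfl

theorem wasserstein_map_map {p : ℝ} (hp : 1 ≤ p) {τ : Measure ℝ} [IsFiniteMeasure τ] {S : Set ℝ}
    (hS : ∀ᵐ z ∂τ, z ∈ S) {f g : ℝ → ℝ} (hf : Measurable f) (hg : Measurable g)
    (hfm : MonotoneOn f S) (hgm : MonotoneOn g S) :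
    wasserstein p (τ.map f) (τ.map g) = (∫⁻ z, edist (f z) (g z) ^ p ∂τ) ^ (1 / p) := by
  have hp0 : 0 < p := by linarith
  apply le_antisymm
  · have hc : IsCoupling (τ.map fun z => (f z, g z)) (τ.map f) (τ.map g) := by
      constructor
      · rw [Measure.map_map measurable_fst (by fun_prop)]; rfl
      · rw [Measure.map_map measurable_snd (by fun_prop)]; rfl
    refine (transportDist_le _ p hc).trans_eq ?_
    rw [lintegral_map (by fun_prop) (by fun_prop)]
  · rw [one_div, ENNReal.rpow_inv_le_iff hp0, ← cdfCost_map_map hp hS hf hg hfm hgm]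
    exact cdfCost_le_wasserstein_rpow hp

/-- Joint measurability in the measure and the threshold is what the interchanges of integrals in
`cdfCost_join_le` require. -/
theorem measurable_measure_Iic_of_isSFiniteKernel {α : Type*} [MeasurableSpace α] (κ : Kernel α ℝ)
    [IsSFiniteKernel κ] : Measurable fun q : α × ℝ => κ q.1 (Iic q.2) := by
  have hm : MeasurableSet {q : (α × ℝ) × ℝ | q.2 ≤ q.1.2} :=
    measurableSet_le (by fun_prop) (by fun_prop)
  exact Kernel.measurable_kernel_prodMk_left (κ := Kernel.prodMkRight ℝ κ) hm

/-- The identity on subprobability measures, extended by `0`, as a kernel. -/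
def subProbKernel : Kernel (Measure ℝ) ℝ where
  toFun P := if P univ ≤ 1 then P else 0
  measurable' := Measurable.ite (measurableSet_le (Measure.measurable_coe MeasurableSet.univ)
    measurable_const) measurable_id measurable_const

instance : IsFiniteKernel subProbKernel :=
  ⟨1, ENNReal.one_lt_top, fun P => by
    change (if P univ ≤ 1 then P else 0) univ ≤ 1
    split_ifs with h
    · exact h
    · simp⟩

theorem subProbKernel_apply {P : Measure ℝ} [IsProbabilityMeasure P] : subProbKernel P = P := by
  change (if P univ ≤ 1 then P else 0) = P
  simp

/-- Joint convexity: `join` is the mean measure, and the truncated difference of two averages is at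
most the average of the truncated differences. Replacing each random measure by its image under
`subProbKernel` changes nothing almost surely and makes the integrand jointly measurable, so Tonelli
applies. -/
theorem cdfCost_join_le {p : ℝ} {π : Measure (Measure ℝ × Measure ℝ)}
    [IsFiniteMeasure π] {L₁ L₂ : Measure (Measure ℝ)} (h : IsCoupling π L₁ L₂)
    (h₁ : ∀ᵐ P ∂L₁, IsProbabilityMeasure P) (h₂ : ∀ᵐ P ∂L₂, IsProbabilityMeasure P) :
    cdfCost p L₁.join L₂.join ≤ ∫⁻ q, cdfCost p q.1 q.2 ∂π := by
  have h₁' : ∀ᵐ q ∂π, subProbKernel q.1 = q.1 := by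
    rw [← h.1] at h₁
    filter_upwards [ae_of_ae_map measurable_fst.aemeasurable h₁] with q hq
    exact subProbKernel_apply
  have h₂' : ∀ᵐ q ∂π, subProbKernel q.2 = q.2 := by
    rw [← h.2] at h₂
    filter_upwards [ae_of_ae_map measurable_snd.aemeasurable h₂] with q hq
    exact subProbKernel_apply
  have e₁ : ∀ s, L₁.join (Iic s) = ∫⁻ q, subProbKernel q.1 (Iic s) ∂π := by
    intro s
    rw [Measure.join_apply measurableSet_Iic, ← h.1, lintegral_map
      (Measure.measurable_coe measurableSet_Iic) measurable_fst]
    refine lintegral_congr_ae ?_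
    filter_upwards [h₁'] with q hq
    rw [hq]
  have e₂ : ∀ s, L₂.join (Iic s) = ∫⁻ q, subProbKernel q.2 (Iic s) ∂π := by
    intro s
    rw [Measure.join_apply measurableSet_Iic, ← h.2, lintegral_map
      (Measure.measurable_coe measurableSet_Iic) measurable_snd]
    refine lintegral_congr_ae ?_
    filter_upwards [h₂'] with q hq
    rw [hq]
  have hM := measurable_measure_Iic_of_isSFiniteKernel subProbKernel
  have hK : ∀ s, Measurable fun P : Measure ℝ => subProbKernel P (Iic s) := fun s =>
    hM.comp (by fun_prop : Measurable fun P : Measure ℝ => (P, s))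
  obtain ⟨F, hFdef⟩ : ∃ F : (Measure ℝ × Measure ℝ) → ℝ → ℝ → ℝ≥0∞, F = fun q w s =>
    (subProbKernel q.1 (Iic s) - subProbKernel q.2 (Iic (s + w))) +
      (subProbKernel q.2 (Iic s) - subProbKernel q.1 (Iic (s + w))) := ⟨_, rfl⟩
  have hF : Measurable fun r : ((Measure ℝ × Measure ℝ) × ℝ) × ℝ => F r.1.1 r.1.2 r.2 := by
    rw [hFdef]
    refine Measurable.add (Measurable.sub ?_ ?_) (Measurable.sub ?_ ?_)
    · exact hM.comp (by fun_prop : Measurable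
        fun r : ((Measure ℝ × Measure ℝ) × ℝ) × ℝ => (r.1.1.1, r.2))
    · exact hM.comp (by fun_prop : Measurable
        fun r : ((Measure ℝ × Measure ℝ) × ℝ) × ℝ => (r.1.1.2, r.2 + r.1.2))
    · exact hM.comp (by fun_prop : Measurable
        fun r : ((Measure ℝ × Measure ℝ) × ℝ) × ℝ => (r.1.1.2, r.2))
    · exact hM.comp (by fun_prop : Measurable
        fun r : ((Measure ℝ × Measure ℝ) × ℝ) × ℝ => (r.1.1.1, r.2 + r.1.2))
  calc cdfCost p L₁.join L₂.join ≤ ∫⁻ w, ∫⁻ s, ∫⁻ q, F q w s ∂π ∂volume ∂kinkMeasure p := by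
        refine lintegral_mono fun w => lintegral_mono fun s => ?_
        have hm : Measurable fun q : Measure ℝ × Measure ℝ =>
            subProbKernel q.1 (Iic s) - subProbKernel q.2 (Iic (s + w)) :=
          ((hK s).comp measurable_fst).sub ((hK (s + w)).comp measurable_snd)
        simp only [e₁, e₂, hFdef]
        rw [lintegral_add_left hm]
        exact add_le_add
          (lintegral_sub_le _ _ ((hK (s + w)).comp measurable_snd))
          (lintegral_sub_le _ _ ((hK (s + w)).comp measurable_fst))
    _ = ∫⁻ w, ∫⁻ q, ∫⁻ s, F q w s ∂volume ∂π ∂kinkMeasure p := by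
        refine lintegral_congr fun w => ?_
        refine lintegral_lintegral_swap (Measurable.aemeasurable ?_)
        exact hF.comp (by fun_prop : Measurable
          fun r : ℝ × (Measure ℝ × Measure ℝ) => ((r.2, w), r.1))
    _ = ∫⁻ q, ∫⁻ w, ∫⁻ s, F q w s ∂volume ∂kinkMeasure p ∂π := by
        refine lintegral_lintegral_swap (Measurable.aemeasurable ?_)
        refine Measurable.lintegral_prod_right' (f := fun r : (ℝ × (Measure ℝ × Measure ℝ)) × ℝ =>
          F r.1.2 r.1.1 r.2) ?_
        exact hF.comp (by fun_prop : Measurable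
          fun r : (ℝ × (Measure ℝ × Measure ℝ)) × ℝ => ((r.1.2, r.1.1), r.2))
    _ = ∫⁻ q, cdfCost p q.1 q.2 ∂π := by
        refine lintegral_congr_ae ?_
        filter_upwards [h₁', h₂'] with q hq₁ hq₂
        simp only [hFdef, hq₁, hq₂, cdfCost]

/-- Passing through `cdfCost` avoids both measurability of the inner Wasserstein distance and a
measurable choice of inner couplings. -/
theorem cdfCost_join_le_wasserstein₂_rpow {p : ℝ} (hp : 1 ≤ p) {L₁ L₂ : Measure (Measure ℝ)}
    [IsFiniteMeasure L₁]
    (h₁ : ∀ᵐ P ∂L₁, IsProbabilityMeasure P) (h₂ : ∀ᵐ P ∂L₂, IsProbabilityMeasure P) :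
    cdfCost p L₁.join L₂.join ≤ wasserstein₂ p L₁ L₂ ^ p := by
  have hp0 : 0 < p := by linarith
  rw [← ENNReal.rpow_inv_le_iff hp0]
  refine le_iInf₂ fun π hπ => ?_
  have : IsFiniteMeasure (π.map Prod.fst) := by rw [hπ.1]; infer_instance
  have : IsFiniteMeasure π := Measure.isFiniteMeasure_of_map measurable_fst.aemeasurable
  rw [one_div]
  refine ENNReal.rpow_le_rpow ((cdfCost_join_le hπ h₁ h₂).trans (lintegral_mono_ae ?_))
    (by positivity)
  rw [← hπ.1] at h₁
  filter_upwards [ae_of_ae_map measurable_fst.aemeasurable h₁] with q hq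
  exact cdfCost_le_wasserstein_rpow hp

/-! ### Quantiles and the unit Fréchet law -/

/-- The limits of the distribution function make the infimum a genuine one, and right continuity
makes it attained. -/
theorem quantile_le_iff (μ : Measure ℝ) {u : ℝ} (h0 : 0 < u) (h1 : u < 1) (x : ℝ) :
    quantile μ u ≤ x ↔ u ≤ cdf μ x := by
  have hbdd : BddBelow {y | u ≤ cdf μ y} := by
    obtain ⟨b, hb⟩ := ((tendsto_cdf_atBot μ).eventually_lt_const h0).exists
    refine ⟨b, fun y hy => ?_⟩
    by_contra hc
    exact absurd (monotone_cdf μ (le_of_not_ge hc)) (not_le.mpr (hb.trans_le hy))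
  have hne : {y | u ≤ cdf μ y}.Nonempty := by
    obtain ⟨b, hb⟩ := ((tendsto_cdf_atTop μ).eventually_const_lt h1).exists
    exact ⟨b, hb.le⟩
  refine ⟨fun h => ?_, fun h => csInf_le hbdd h⟩
  have hr : Tendsto (cdf μ) (𝓝[>] x) (𝓝 (cdf μ x)) :=
    ((cdf μ).right_continuous x).mono_left (nhdsWithin_mono _ Ioi_subset_Ici_self)
  refine ge_of_tendsto hr ?_
  filter_upwards [self_mem_nhdsWithin] with y hy
  obtain ⟨z, hz, hzy⟩ := exists_lt_of_csInf_lt hne (lt_of_le_of_lt h hy)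
  exact le_trans hz (monotone_cdf μ hzy.le)

theorem quantile_mono (μ : Measure ℝ) {u v : ℝ} (h0 : 0 < u) (h1 : v < 1) (huv : u ≤ v) :
    quantile μ u ≤ quantile μ v := by
  rw [quantile_le_iff μ h0 (huv.trans_lt h1)]
  exact huv.trans ((quantile_le_iff μ (h0.trans_le huv) h1 _).mp le_rfl)

theorem exp_neg_one_div_lt_one {t : ℝ} (ht : 0 < t) : Real.exp (-1 / t) < 1 := by
  rw [Real.exp_lt_one_iff]
  exact div_neg_of_neg_of_pos (by norm_num) ht

theorem tailV_le_iff (μ : Measure ℝ) {t : ℝ} (ht : 0 < t) (x : ℝ) :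
    tailV μ t ≤ x ↔ Real.exp (-1 / t) ≤ cdf μ x :=
  quantile_le_iff μ (Real.exp_pos _) (exp_neg_one_div_lt_one ht) x

theorem tailV_monotoneOn (μ : Measure ℝ) : MonotoneOn (tailV μ) (Ioi 0) := by
  intro s hs t ht hst
  refine quantile_mono μ (Real.exp_pos _) (exp_neg_one_div_lt_one ht) (Real.exp_le_exp.mpr ?_)
  rw [neg_div, neg_div]
  exact neg_le_neg (one_div_le_one_div_of_le hs hst)

theorem quantile_eq_zero_of_one_lt (μ : Measure ℝ) {u : ℝ} (hu : 1 < u) : quantile μ u = 0 := by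
  have : {x | u ≤ cdf μ x} = ∅ := by
    ext x
    simp only [mem_ofPred_eq, mem_empty_iff_false, iff_false, not_le]
    exact (cdf_le_one μ x).trans_lt hu
  rw [quantile, this, Real.sInf_empty]

/-- For t < 0 the level exp(-1/t) exceeds 1, and the default value `sInf ∅ = 0` makes the function
constant there; t = 0 is a single point. -/
theorem tailV_measurable (μ : Measure ℝ) : Measurable (tailV μ) := by
  refine measurable_of_Iic fun x => ?_
  have : tailV μ ⁻¹' Iic x = (Ioi 0 ∩ {t | Real.exp (-1 / t) ≤ cdf μ x}) ∪
      ((Iio 0 ∩ {_t | 0 ≤ x}) ∪ ({0} ∩ {_t | tailV μ 0 ≤ x})) := by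
    ext t
    simp only [mem_preimage, mem_Iic, mem_union, mem_inter_iff, mem_Ioi, mem_Iio,
      mem_singleton_iff, mem_ofPred_eq]
    rcases lt_trichotomy t 0 with h | rfl | h
    · have hu : 1 < Real.exp (-1 / t) :=
        Real.one_lt_exp_iff.mpr (div_pos_of_neg_of_neg (by norm_num) h)
      have : tailV μ t = 0 := quantile_eq_zero_of_one_lt μ hu
      simp [this, h, h.ne, not_lt.mpr h.le]
    · simp
    · rw [tailV_le_iff μ h]
      simp [h, h.ne', not_lt.mpr h.le]
  rw [this]
  refine (measurableSet_Ioi.inter (measurableSet_le (by fun_prop) (by fun_prop))).union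
    ((measurableSet_Iio.inter (MeasurableSet.const _)).union
      ((measurableSet_singleton _).inter (MeasurableSet.const _)))

theorem boxCox_measurable (γ : ℝ) : Measurable (boxCox γ) := by
  unfold boxCox
  split_ifs <;> fun_prop

/-- This is the counterpart of `tailV_le_iff` for G_γ: the Box–Cox function is its quantile function
read along u = exp(-1/z). -/
theorem boxCox_le_iff (γ : ℝ) {z : ℝ} (hz : 0 < z) (s : ℝ) :
    boxCox γ z ≤ s ↔ Real.exp (-1 / z) ≤ gevFun γ s := by
  unfold boxCox gevFun
  split_ifs with h0 h1 h2
  · rw [Real.exp_le_exp, neg_div, neg_le_neg_iff, Real.exp_neg, ← one_div,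
      one_div_le_one_div (Real.exp_pos s) hz, Real.log_le_iff_le_exp hz]
  · rw [Real.exp_le_exp, neg_div, neg_le_neg_iff, one_div]
    set w := (1 + γ * s) ^ (-1 / γ) with hw
    have hwpos : 0 < w := Real.rpow_pos_of_pos h1 _
    have hy : 1 + γ * s = w ^ (-γ) := by
      rw [hw, ← Real.rpow_mul h1.le]
      field_simp
      simp
    have hz' : z ^ γ = (z⁻¹) ^ (-γ) := by rw [Real.inv_rpow hz.le, Real.rpow_neg hz.le, inv_inv]
    have hv : 0 < z⁻¹ := inv_pos.mpr hz
    rcases lt_or_gt_of_ne h0 with hneg | hpos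
    · rw [div_le_iff_of_neg hneg, ← Real.rpow_le_rpow_iff hwpos.le hv.le (neg_pos.mpr hneg), ← hz',
        ← hy]
      constructor <;> intro h <;> nlinarith
    · rw [div_le_iff₀ hpos, ← Real.rpow_le_rpow_iff_of_neg hv hwpos (neg_lt_zero.mpr hpos),
        ← hz', ← hy]
      constructor <;> intro h <;> nlinarith
  -- Here s is at or beyond the right endpoint -1/γ, which the Box–Cox function never exceeds; in
  -- the next case s is at or below the left endpoint.
  · have := Real.rpow_pos_of_pos hz γ
    refine iff_of_true ?_ (exp_neg_one_div_lt_one hz).le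
    rw [div_le_iff_of_neg h2]
    nlinarith
  · have h3 : 0 < γ := lt_of_le_of_ne (not_lt.mp h2) (Ne.symm h0)
    have := Real.rpow_pos_of_pos hz γ
    refine iff_of_false ?_ (not_le.mpr (Real.exp_pos _))
    rw [div_le_iff₀ h3]
    nlinarith

theorem boxCox_monotoneOn (γ : ℝ) : MonotoneOn (boxCox γ) (Ioi 0) := by
  intro s hs t ht hst
  rw [boxCox_le_iff γ hs]
  refine le_trans ?_ ((boxCox_le_iff γ ht _).mp le_rfl)
  rw [Real.exp_le_exp, neg_div, neg_div]
  exact neg_le_neg (one_div_le_one_div_of_le hs hst)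

/-- The unit Fréchet law. -/
def frechet : Measure ℝ :=
  (volume.restrict (Ioi 0)).withDensity fun z => ENNReal.ofReal (Real.exp (-1 / z) / z ^ 2)

theorem hasDerivAt_exp_neg_one_div {z : ℝ} (hz : z ≠ 0) :
    HasDerivAt (fun z => Real.exp (-1 / z)) (Real.exp (-1 / z) / z ^ 2) z := by
  have h : HasDerivAt (fun z : ℝ => -1 / z) (1 / z ^ 2) z := by
    have := (hasDerivAt_inv hz).neg
    simpa [neg_div, Pi.neg_def, one_div] using this
  simpa [div_eq_mul_one_div (Real.exp (-1 / z))] using h.exp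

/-- `expNegInvGlue` extends exp(-1/z) continuously by 0, so the fundamental theorem of calculus also
covers s = 0. -/
theorem frechet_Ioi {s : ℝ} (hs : 0 ≤ s) :
    frechet (Ioi s) = ENNReal.ofReal (1 - expNegInvGlue s) := by
  have hcont : ContinuousWithinAt expNegInvGlue (Ici s) s :=
    (expNegInvGlue.contDiff (n := 0)).continuous.continuousWithinAt
  have hderiv : ∀ x ∈ Ioi s, HasDerivAt expNegInvGlue (Real.exp (-1 / x) / x ^ 2) x := by
    intro x hx
    have hx0 : 0 < x := hs.trans_lt hx
    refine (hasDerivAt_exp_neg_one_div hx0.ne').congr_of_eventuallyEq ?_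
    filter_upwards [Ioi_mem_nhds hx0] with y hy
    have hy : 0 < y := hy
    simp [expNegInvGlue, not_le.mpr hy, neg_div]
  have hpos : ∀ x ∈ Ioi s, 0 ≤ Real.exp (-1 / x) / x ^ 2 := fun x _ => by positivity
  have hlim : Tendsto expNegInvGlue atTop (𝓝 1) := by
    have h1 : Tendsto (fun x : ℝ => Real.exp (-x⁻¹)) atTop (𝓝 1) := by
      simpa [Function.comp_def] using
        (Real.continuous_exp.tendsto _).comp (tendsto_inv_atTop_zero (𝕜 := ℝ)).neg
    refine h1.congr' ?_
    filter_upwards [eventually_gt_atTop 0] with x hx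
    simp [expNegInvGlue, not_le.mpr hx]
  have hint := integrableOn_Ioi_deriv_of_nonneg hcont hderiv hpos hlim
  have hval := integral_Ioi_of_hasDerivAt_of_nonneg hcont hderiv hpos hlim
  rw [frechet, withDensity_apply _ measurableSet_Ioi, Measure.restrict_restrict measurableSet_Ioi,
    Ioi_inter_Ioi, sup_of_le_left hs, ← hval, ofReal_integral_eq_lintegral_ofReal hint]
  exact (ae_restrict_iff' measurableSet_Ioi).mpr (ae_of_all _ hpos)

theorem frechet_pos : ∀ᵐ z ∂frechet, z ∈ Ioi (0 : ℝ) :=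
  (withDensity_absolutelyContinuous _ _).ae_le (ae_restrict_mem measurableSet_Ioi)

instance : IsProbabilityMeasure frechet := by
  constructor
  have h : frechet univ = frechet (Ioi 0) := by
    refine measure_congr ?_
    filter_upwards [frechet_pos] with z hz
    exact propext ⟨fun _ => hz, fun _ => trivial⟩
  rw [h, frechet_Ioi le_rfl]
  simp [expNegInvGlue]

/-- Probability integral transform: exp(-1/Z) is uniform on (0, 1). -/
theorem frechet_setOf_exp_le {c : ℝ} (h0 : 0 ≤ c) (h1 : c ≤ 1) :
    frechet {z | Real.exp (-1 / z) ≤ c} = ENNReal.ofReal c := by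
  rcases h0.eq_or_lt with rfl | h0
  · simp [not_le.mpr (Real.exp_pos _)]
  rcases h1.eq_or_lt with rfl | h1
  · rw [ENNReal.ofReal_one, ← measure_univ (μ := frechet)]
    refine measure_congr ?_
    filter_upwards [frechet_pos] with z hz
    exact propext ⟨fun _ => trivial, fun _ => (exp_neg_one_div_lt_one hz).le⟩
  have hl : Real.log c < 0 := Real.log_neg h0 h1
  set s := -1 / Real.log c with hs
  have hs0 : 0 < s := div_pos_of_neg_of_neg (by norm_num) hl
  have hsl : -1 / s = Real.log c := by rw [hs]; field_simp
  have hset : frechet {z | Real.exp (-1 / z) ≤ c} = frechet (Ioi s)ᶜ := by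
    refine measure_congr ?_
    filter_upwards [frechet_pos] with z hz
    have hz : 0 < z := hz
    refine propext ?_
    change Real.exp (-1 / z) ≤ c ↔ ¬ (s < z)
    rw [← Real.le_log_iff_exp_le h0, ← hsl, neg_div, neg_div, neg_le_neg_iff,
      one_div_le_one_div hs0 hz, not_lt]
  have hg : expNegInvGlue s = c := by
    have : -s⁻¹ = -1 / s := by rw [neg_div, one_div]
    simp [expNegInvGlue, not_le.mpr hs0, this, hsl, Real.exp_log h0]
  rw [hset, prob_compl_eq_one_sub measurableSet_Ioi, frechet_Ioi hs0.le, hg,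
    ← ENNReal.ofReal_one, ← ENNReal.ofReal_sub _ (by linarith)]
  congr 1; ring

theorem frechet_map_Iic {f : ℝ → ℝ} (hf : Measurable f) {s c : ℝ} (h0 : 0 ≤ c) (h1 : c ≤ 1)
    (h : ∀ z, 0 < z → (f z ≤ s ↔ Real.exp (-1 / z) ≤ c)) :
    frechet.map f (Iic s) = ENNReal.ofReal c := by
  rw [Measure.map_apply hf measurableSet_Iic, ← frechet_setOf_exp_le h0 h1]
  refine measure_congr ?_
  filter_upwards [frechet_pos] with z hz
  exact propext (h z hz)

theorem frechet_map_boxCox (γ : ℝ) : frechet.map (boxCox γ) = gev γ := by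
  refine (Measure.ext_of_Iic _ _ fun s => ?_).symm
  have hc := cdf_gev γ s
  rw [frechet_map_Iic (boxCox_measurable γ) (c := gevFun γ s) (hc ▸ cdf_nonneg _ _)
    (hc ▸ cdf_le_one _ _) (fun z hz => boxCox_le_iff γ hz s), ← hc, ofReal_cdf]

/-- The function `z ↦ (V(t z) - V(t)) / a(t)`. -/
def incr (μ : Measure ℝ) (a : ℝ → ℝ) (t z : ℝ) : ℝ := (tailV μ (t * z) - tailV μ t) / a t

theorem incr_measurable (μ : Measure ℝ) (a : ℝ → ℝ) (t : ℝ) : Measurable (incr μ a t) :=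
  (((tailV_measurable μ).comp (measurable_const_mul t)).sub_const _).div_const _

theorem incr_monotoneOn (μ : Measure ℝ) {a : ℝ → ℝ} {t : ℝ} (ht : 0 < t) (ha : 0 < a t) :
    MonotoneOn (incr μ a t) (Ioi 0) := by
  intro x hx y hy hxy
  have hx : 0 < x := hx
  have hy : 0 < y := hy
  unfold incr
  have := tailV_monotoneOn μ (mul_pos ht hx : t * x ∈ Ioi 0) (mul_pos ht hy : t * y ∈ Ioi 0)
    (mul_le_mul_of_nonneg_left hxy ht.le)
  gcongr

theorem approxRate_eq (μ : Measure ℝ) (γ : ℝ) (a : ℝ → ℝ) {p : ℝ} (hp : 1 ≤ p) (t : ℝ) :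
    approxRate μ γ a p t
      = (∫⁻ z, edist (incr μ a t z) (boxCox γ z) ^ p ∂frechet) ^ (1 / p) := by
  have hm := incr_measurable μ a t
  have hm' := boxCox_measurable γ
  rw [frechet, lintegral_withDensity_eq_lintegral_mul _ (by fun_prop) (by fun_prop)]
  unfold approxRate
  congr 1
  refine lintegral_congr fun z => ?_
  rw [Pi.mul_apply, edist_dist, Real.dist_eq,
    ENNReal.ofReal_rpow_of_nonneg (abs_nonneg _) (by linarith),
    ← ENNReal.ofReal_mul (by positivity), mul_comm]
  rfl

/-! ### Laws of block maxima and of empirical measures -/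

/-- The law of the maximum of `m` independent variables with law `μ`. -/
def maxLaw (μ : Measure ℝ) (m : ℕ) : Measure ℝ :=
  (Measure.pi fun _ : Fin m => μ).map fun y => ⨆ j, y j

theorem measurable_iSup_fin (m : ℕ) : Measurable fun y : Fin m → ℝ => ⨆ j, y j :=
  Measurable.iSup fun j => measurable_pi_apply j

theorem maxLaw_Iic (μ : Measure ℝ) [IsProbabilityMeasure μ] {m : ℕ} (hm : 1 ≤ m) (s : ℝ) :
    maxLaw μ m (Iic s) = ENNReal.ofReal (cdf μ s ^ m) := by
  have : Nonempty (Fin m) := ⟨⟨0, hm⟩⟩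
  rw [maxLaw, Measure.map_apply (measurable_iSup_fin m) measurableSet_Iic]
  have : (fun y : Fin m → ℝ => ⨆ j, y j) ⁻¹' Iic s = Set.pi univ fun _ => Iic s := by
    ext y
    simp only [mem_preimage, mem_Iic, Set.mem_pi, mem_univ, true_imp_iff]
    exact ciSup_le_iff (Set.finite_range y).bddAbove
  rw [this, Measure.pi_pi, Finset.prod_const, Finset.card_univ, Fintype.card_fin,
    ENNReal.ofReal_pow (cdf_nonneg _ _), ofReal_cdf]

/-- The m-th root of exp(-1/z) is exp(-1/(mz)), so F(x)^m ≥ exp(-1/z) amounts to V(mz) ≤ x. This is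
why V, and not U, gives an identity for every m. -/
theorem maxLaw_map_eq (μ : Measure ℝ) [IsProbabilityMeasure μ] {a : ℝ → ℝ} {m : ℕ} (hm : 1 ≤ m)
    (ha : 0 < a m) :
    (maxLaw μ m).map (fun x => (x - tailV μ m) / a m) = frechet.map (incr μ a m) := by
  have hm0 : (0 : ℝ) < m := by exact_mod_cast hm
  refine (Measure.ext_of_Iic _ _ fun s => ?_).symm
  have hc := cdf_nonneg μ (s * a m + tailV μ m)
  rw [frechet_map_Iic (incr_measurable μ a m) (c := cdf μ (s * a m + tailV μ m) ^ m)
    (by positivity) (pow_le_one₀ hc (cdf_le_one _ _)), ← maxLaw_Iic μ hm,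
    Measure.map_apply (by fun_prop) measurableSet_Iic]
  · congr 1
    ext x
    simp [div_le_iff₀ ha]
  · intro z hz
    have he : Real.exp (-1 / z) = Real.exp (-1 / (m * z)) ^ m := by
      rw [← Real.exp_nat_mul]; congr 1; field_simp
    rw [incr, div_le_iff₀ ha, sub_le_iff_le_add, tailV_le_iff μ (mul_pos hm0 hz), he,
      pow_le_pow_iff_left₀ (Real.exp_pos _).le hc (by omega)]

section Blocks

variable {Ω : Type*} [MeasurableSpace Ω] {P : Measure Ω} [IsProbabilityMeasure P]
  {X : ℕ → Ω → ℝ} {μ : Measure ℝ}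

theorem map_pi_of_iIndepFun {ι : Type*} [Fintype ι] {Z : ι → Ω → ℝ}
    (hlaw : ∀ i, HasLaw (Z i) μ P) (hind : iIndepFun Z P) :
    P.map (fun ω i => Z i ω) = Measure.pi fun _ : ι => μ := by
  rw [(iIndepFun_iff_map_fun_eq_pi_map fun i => (hlaw i).aemeasurable).mp hind]
  congr 1
  funext i
  exact (hlaw i).map_eq

variable [IsProbabilityMeasure μ]

theorem map_blocks (hXlaw : ∀ j, HasLaw (X j) μ P) (hXind : iIndepFun X P) (k : ℕ) {m : ℕ}
    (hm : 1 ≤ m) :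
    P.map (fun ω (i : Fin k) (j : Fin m) => X (i * m + j) ω)
      = Measure.pi fun _ : Fin k => Measure.pi fun _ : Fin m => μ := by
  -- Quotient and remainder by m recover the block and the position, so the variables read off are
  -- distinct members of the independent family.
  have hinj : Function.Injective fun q : Fin k × Fin m => (q.1 : ℕ) * m + q.2 := by
    rintro ⟨i, j⟩ ⟨i', j'⟩ h
    simp only at h
    have h1 : ((i : ℕ) * m + j) / m = i := by
      rw [mul_comm, Nat.mul_add_div (by omega), Nat.div_eq_of_lt j.2, add_zero]
    have h2 : ((i' : ℕ) * m + j') / m = i' := by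
      rw [mul_comm, Nat.mul_add_div (by omega), Nat.div_eq_of_lt j'.2, add_zero]
    have h3 : (i : ℕ) = i' := by rw [← h1, ← h2, h]
    rw [h3] at h
    exact Prod.ext (Fin.ext h3) (Fin.ext (by simpa using h))
  have h1 := map_pi_of_iIndepFun (fun q : Fin k × Fin m => hXlaw (q.1 * m + q.2))
    (hXind.precomp hinj)
  have h2 := Measure.infinitePi_map_curry (fun (_ : Fin k) (_ : Fin m) => μ)
  simp only [Measure.infinitePi_eq_pi] at h2
  rw [← h2, ← h1, AEMeasurable.map_map_of_aemeasurable (by fun_prop)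
    (aemeasurable_pi_lambda _ fun q => (hXlaw _).aemeasurable)]
  rfl

theorem map_normBlockMax (hXlaw : ∀ j, HasLaw (X j) μ P) (hXind : iIndepFun X P) {a : ℝ → ℝ}
    (k : ℕ) {m : ℕ} (hm : 1 ≤ m) (ha : 0 < a m) :
    P.map (fun ω (i : Fin k) => normBlockMax μ a m (fun j => X j ω) i)
      = Measure.pi fun _ : Fin k => frechet.map (incr μ a m) := by
  have hs : Measurable fun y : Fin m → ℝ => ((⨆ j, y j) - tailV μ m) / a m :=
    ((measurable_iSup_fin m).sub_const _).div_const _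
  have h : (Measure.pi fun _ : Fin m => μ).map (fun y => ((⨆ j, y j) - tailV μ m) / a m)
      = frechet.map (incr μ a m) := by
    rw [← maxLaw_map_eq μ hm ha, maxLaw, Measure.map_map (by fun_prop) (measurable_iSup_fin m)]
    rfl
  have : ∀ _ : Fin k, SigmaFinite ((Measure.pi fun _ : Fin m => μ).map
      fun y => ((⨆ j, y j) - tailV μ m) / a m) := fun _ => by rw [h]; infer_instance
  rw [← h, ← Measure.pi_map_pi (fun _ => hs.aemeasurable), ← map_blocks hXlaw hXind k hm,
    AEMeasurable.map_map_of_aemeasurable]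
  · rfl
  · exact (measurable_pi_lambda _ fun i => hs.comp (measurable_pi_apply i)).aemeasurable
  · exact aemeasurable_pi_lambda _ fun i => aemeasurable_pi_lambda _ fun j =>
      (hXlaw _).aemeasurable

theorem map_normBlockMax_zero (hXlaw : ∀ j, HasLaw (X j) μ P) (hXind : iIndepFun X P) {a : ℝ → ℝ}
    {m : ℕ} (hm : 1 ≤ m) (ha : 0 < a m) :
    P.map (fun ω => normBlockMax μ a m (fun j => X j ω) 0) = frechet.map (incr μ a m) := by
  have := congrArg (fun ν => ν.map (Function.eval (0 : Fin 1)))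
    (map_normBlockMax hXlaw hXind 1 hm ha)
  have hpr : IsProbabilityMeasure (frechet.map (incr μ a m)) :=
    Measure.isProbabilityMeasure_map (incr_measurable μ a m).aemeasurable
  simp only [(measurePreserving_eval _ _).map_eq] at this
  rw [← this, AEMeasurable.map_map_of_aemeasurable (measurable_pi_apply 0).aemeasurable]
  · rfl
  · refine aemeasurable_pi_lambda _ fun i => ?_
    exact ((AEMeasurable.iSup fun j => (hXlaw _).aemeasurable).sub_const _).div_const _

end Blocks

/-- The empirical measure of a finite tuple. -/
def tupleEmpirical {k : ℕ} (x : Fin k → ℝ) : Measure ℝ :=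
  (k : ℝ≥0∞)⁻¹ • ∑ i, Measure.dirac (x i)

theorem empiricalMeasure_eq (k : ℕ) (x : ℕ → ℝ) :
    empiricalMeasure k x = tupleEmpirical fun i : Fin k => x i := by
  rw [empiricalMeasure, tupleEmpirical, Finset.sum_range fun i => Measure.dirac (x i)]

theorem tupleEmpirical_apply {k : ℕ} (x : Fin k → ℝ) {B : Set ℝ} (hB : MeasurableSet B) :
    tupleEmpirical x B = (k : ℝ≥0∞)⁻¹ * ∑ i, B.indicator 1 (x i) := by
  simp [tupleEmpirical, Measure.dirac_apply' _ hB]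

theorem tupleEmpirical_measurable (k : ℕ) :
    Measurable (tupleEmpirical : (Fin k → ℝ) → Measure ℝ) := by
  refine Measure.measurable_of_measurable_coe _ fun B hB => ?_
  simp only [tupleEmpirical_apply _ hB]
  refine Measurable.const_mul (Finset.measurable_sum _ fun i _ => ?_) _
  exact (measurable_one.indicator hB).comp (measurable_pi_apply i)

theorem tupleEmpirical_isProbabilityMeasure {k : ℕ} (hk : 1 ≤ k) (x : Fin k → ℝ) :
    IsProbabilityMeasure (tupleEmpirical x) := by
  constructor
  rw [tupleEmpirical_apply _ MeasurableSet.univ]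
  simp only [indicator_univ, Pi.one_apply, Finset.sum_const, Finset.card_univ, Fintype.card_fin,
    nsmul_eq_mul, mul_one]
  exact ENNReal.inv_mul_cancel (by simp; omega) (ENNReal.natCast_ne_top k)

theorem average_const {k : ℕ} (hk : 1 ≤ k) (c : ℝ≥0∞) :
    (k : ℝ≥0∞)⁻¹ * ∑ _i : Fin k, c = c := by
  rw [Finset.sum_const, Finset.card_univ, Fintype.card_fin, nsmul_eq_mul, ← mul_assoc,
    ENNReal.inv_mul_cancel (by simp; omega) (ENNReal.natCast_ne_top k), one_mul]

/-- Taking means erases the sample size, which reduces the lower bound between laws of random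
measures to one on the line. -/
theorem join_map_tupleEmpirical {k : ℕ} (hk : 1 ≤ k) (ν : Measure ℝ) [IsProbabilityMeasure ν] :
    ((Measure.pi fun _ : Fin k => ν).map tupleEmpirical).join = ν := by
  refine Measure.ext fun B hB => ?_
  rw [Measure.join_apply hB, lintegral_map (Measure.measurable_coe hB)
    (tupleEmpirical_measurable k)]
  simp only [tupleEmpirical_apply _ hB]
  have hm : ∀ i : Fin k, Measurable fun x : Fin k → ℝ => B.indicator (1 : ℝ → ℝ≥0∞) (x i) :=
    fun i => (measurable_one.indicator hB).comp (measurable_pi_apply i)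
  rw [lintegral_const_mul _ (Finset.measurable_sum _ fun i _ => hm i),
    lintegral_finsetSum _ fun i _ => hm i]
  have : ∀ i : Fin k, ∫⁻ x : Fin k → ℝ, B.indicator (1 : ℝ → ℝ≥0∞) (x i)
      ∂(Measure.pi fun _ : Fin k => ν) = ν B := by
    intro i
    rw [← lintegral_indicator_one hB]
    exact (measurePreserving_eval (fun _ : Fin k => ν) i).lintegral_comp
      (measurable_one.indicator hB)
  simp only [this]
  exact average_const hk _

theorem map_sum_dirac {α β ι : Type*} [MeasurableSpace α] [MeasurableSpace β] [Fintype ι]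
    {f : α → β} (hf : Measurable f) (x : ι → α) :
    (∑ i, Measure.dirac (x i)).map f = ∑ i, Measure.dirac (f (x i)) := by
  refine Measure.ext fun B hB => ?_
  rw [Measure.map_apply hf hB]
  simp [Measure.dirac_apply' _ hB, Measure.dirac_apply' _ (hf hB)]
  rfl

/-- Atoms are coupled index by index; no sorting is needed for an upper bound. -/
theorem wasserstein_tupleEmpirical_le {p : ℝ} (hp : 1 ≤ p) {k : ℕ} (x y : Fin k → ℝ) :
    wasserstein p (tupleEmpirical x) (tupleEmpirical y) ^ p
      ≤ (k : ℝ≥0∞)⁻¹ * ∑ i, edist (x i) (y i) ^ p := by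
  have hc : IsCoupling ((k : ℝ≥0∞)⁻¹ • ∑ i, Measure.dirac (x i, y i)) (tupleEmpirical x)
      (tupleEmpirical y) := by
    constructor
    · rw [Measure.map_smul, map_sum_dirac measurable_fst]
      rfl
    · rw [Measure.map_smul, map_sum_dirac measurable_snd]
      rfl
  have hp0 : 0 < p := by linarith
  rw [← ENNReal.le_rpow_inv_iff hp0, ← one_div]
  refine (transportDist_le _ p hc).trans_eq ?_
  rw [lintegral_smul_measure, lintegral_finsetSum_measure]
  simp

theorem wasserstein₂_map_tupleEmpirical {p : ℝ} (hp : 1 ≤ p) {k : ℕ} (hk : 1 ≤ k) {τ : Measure ℝ}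
    [IsProbabilityMeasure τ] {S : Set ℝ} (hS : ∀ᵐ z ∂τ, z ∈ S) {f g : ℝ → ℝ} (hf : Measurable f)
    (hg : Measurable g) (hfm : MonotoneOn f S) (hgm : MonotoneOn g S) :
    wasserstein₂ p ((Measure.pi fun _ : Fin k => τ.map f).map tupleEmpirical)
      ((Measure.pi fun _ : Fin k => τ.map g).map tupleEmpirical)
      = (∫⁻ z, edist (f z) (g z) ^ p ∂τ) ^ (1 / p) := by
  have hp0 : 0 < p := by linarith
  have hpf : IsProbabilityMeasure (τ.map f) := Measure.isProbabilityMeasure_map hf.aemeasurable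
  have hpg : IsProbabilityMeasure (τ.map g) := Measure.isProbabilityMeasure_map hg.aemeasurable
  have hE := tupleEmpirical_measurable k
  have hprob : ∀ ν : Measure (Fin k → ℝ), ∀ᵐ Q ∂ν.map tupleEmpirical, IsProbabilityMeasure Q := by
    intro ν
    have : ∀ᵐ Q ∂ν.map tupleEmpirical, (Q : Measure ℝ) univ = 1 := by
      rw [ae_map_iff hE.aemeasurable
        (measurableSet_eq_fun (Measure.measurable_coe MeasurableSet.univ) measurable_const)]
      exact ae_of_all _ fun x => (tupleEmpirical_isProbabilityMeasure hk x).measure_univ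
    filter_upwards [this] with Q hQ using ⟨hQ⟩
  have hF : Measurable fun z : Fin k → ℝ => fun i => f (z i) :=
    measurable_pi_lambda _ fun i => hf.comp (measurable_pi_apply i)
  have hG : Measurable fun z : Fin k → ℝ => fun i => g (z i) :=
    measurable_pi_lambda _ fun i => hg.comp (measurable_pi_apply i)
  have hmapf : (Measure.pi fun _ : Fin k => τ).map (fun z i => f (z i))
      = Measure.pi fun _ => τ.map f := Measure.pi_map_pi fun _ => hf.aemeasurable
  have hmapg : (Measure.pi fun _ : Fin k => τ).map (fun z i => g (z i))
      = Measure.pi fun _ => τ.map g := Measure.pi_map_pi fun _ => hg.aemeasurable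
  have hFG : Measurable fun z : Fin k → ℝ =>
      (tupleEmpirical fun i => f (z i), tupleEmpirical fun i => g (z i)) :=
    (hE.comp hF).prodMk (hE.comp hG)
  apply le_antisymm
  · have hc : IsCoupling ((Measure.pi fun _ : Fin k => τ).map fun z =>
          (tupleEmpirical fun i => f (z i), tupleEmpirical fun i => g (z i)))
        ((Measure.pi fun _ : Fin k => τ.map f).map tupleEmpirical)
        ((Measure.pi fun _ : Fin k => τ.map g).map tupleEmpirical) := by
      constructor
      · rw [Measure.map_map measurable_fst hFG, ← hmapf,
          Measure.map_map hE hF]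
        rfl
      · rw [Measure.map_map measurable_snd hFG, ← hmapg,
          Measure.map_map hE hG]
        rfl
    refine (transportDist_le _ p hc).trans (ENNReal.rpow_le_rpow ?_ (by positivity))
    have hm : Measurable fun z => edist (f z) (g z) ^ p := by fun_prop
    -- The inequality `lintegral_map_le` holds for arbitrary integrands, so measurability of the
    -- Wasserstein distance is not needed.
    calc _ ≤ ∫⁻ z : Fin k → ℝ, wasserstein p (tupleEmpirical fun i => f (z i))
            (tupleEmpirical fun i => g (z i)) ^ p ∂(Measure.pi fun _ : Fin k => τ) :=
          lintegral_map_le _ _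
      _ ≤ ∫⁻ z : Fin k → ℝ, (k : ℝ≥0∞)⁻¹ * ∑ i, edist (f (z i)) (g (z i)) ^ p
            ∂(Measure.pi fun _ : Fin k => τ) :=
          lintegral_mono fun z => wasserstein_tupleEmpirical_le hp _ _
      _ = ∫⁻ z, edist (f z) (g z) ^ p ∂τ := by
          have hmi : ∀ i : Fin k, Measurable fun z : Fin k → ℝ => edist (f (z i)) (g (z i)) ^ p :=
            fun i => hm.comp (measurable_pi_apply i)
          rw [lintegral_const_mul _ (Finset.measurable_sum _ fun i _ => hmi i),
            lintegral_finsetSum _ fun i _ => hmi i]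
          have : ∀ i : Fin k, ∫⁻ z : Fin k → ℝ, edist (f (z i)) (g (z i)) ^ p
              ∂(Measure.pi fun _ : Fin k => τ) = ∫⁻ z, edist (f z) (g z) ^ p ∂τ := fun i =>
            (measurePreserving_eval (fun _ : Fin k => τ) i).lintegral_comp hm
          simp only [this]
          exact average_const hk _
  · rw [one_div, ENNReal.rpow_inv_le_iff hp0, ← cdfCost_map_map hp hS hf hg hfm hgm]
    have := cdfCost_join_le_wasserstein₂_rpow hp (hprob (Measure.pi fun _ : Fin k => τ.map f))
      (hprob (Measure.pi fun _ : Fin k => τ.map g))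
    rwa [join_map_tupleEmpirical hk, join_map_tupleEmpirical hk] at this

theorem map_empiricalMeasure {Ω : Type*} [MeasurableSpace Ω] {P : Measure Ω} {Z : ℕ → Ω → ℝ}
    (hZ : ∀ i, AEMeasurable (Z i) P) (k : ℕ) :
    P.map (fun ω => empiricalMeasure k fun i => Z i ω)
      = (P.map fun ω (i : Fin k) => Z i ω).map tupleEmpirical := by
  simp only [empiricalMeasure_eq]
  rw [AEMeasurable.map_map_of_aemeasurable (tupleEmpirical_measurable k).aemeasurable
    (aemeasurable_pi_lambda _ fun i => hZ i)]
  rfl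

/-! ### Exact distances for block maxima -/

section Main

variable {Ω : Type*} [MeasurableSpace Ω] {P : Measure Ω} [IsProbabilityMeasure P]
  {X : ℕ → Ω → ℝ} {μ : Measure ℝ} [IsProbabilityMeasure μ]
  {Ω' : Type*} [MeasurableSpace Ω'] {P' : Measure Ω'} [IsProbabilityMeasure P']
  {Y : ℕ → Ω' → ℝ}

theorem wasserstein_eq_approxRate {p : ℝ} (hp : 1 ≤ p) (γ : ℝ) {a : ℝ → ℝ}
    (hXlaw : ∀ j, HasLaw (X j) μ P) (hXind : iIndepFun X P) {m : ℕ} (hm : 1 ≤ m) (ha : 0 < a m) :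
    wasserstein p (P.map fun ω => normBlockMax μ a m (fun j => X j ω) 0) (gev γ)
      = approxRate μ γ a p m := by
  have hm0 : (0 : ℝ) < m := by exact_mod_cast hm
  rw [map_normBlockMax_zero hXlaw hXind hm ha, ← frechet_map_boxCox, approxRate_eq _ _ _ hp]
  exact wasserstein_map_map hp frechet_pos (incr_measurable μ a m) (boxCox_measurable γ)
    (incr_monotoneOn μ hm0 ha) (boxCox_monotoneOn γ)

theorem wasserstein₂_eq_approxRate {p : ℝ} (hp : 1 ≤ p) {γ : ℝ} {a : ℝ → ℝ}
    (hXlaw : ∀ j, HasLaw (X j) μ P) (hXind : iIndepFun X P)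
    (hYlaw : ∀ i, HasLaw (Y i) (gev γ) P') (hYind : iIndepFun Y P')
    {n m : ℕ} (hm : 1 ≤ m) (hmn : m ≤ n) (ha : 0 < a m) :
    wasserstein₂ p (lawEmpiricalMaxima P X μ a n m) (lawEmpirical P' Y (n / m))
      = approxRate μ γ a p m := by
  have hm0 : (0 : ℝ) < m := by exact_mod_cast hm
  -- At least one full block, so that the empirical measures are probability measures.
  have hk : 1 ≤ n / m := (Nat.one_le_div_iff (by omega)).mpr hmn
  have hZ : ∀ i, AEMeasurable (fun ω => normBlockMax μ a m (fun j => X j ω) i) P := fun i =>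
    ((AEMeasurable.iSup fun j => (hXlaw _).aemeasurable).sub_const _).div_const _
  rw [lawEmpiricalMaxima, lawEmpirical, map_empiricalMeasure hZ,
    map_empiricalMeasure fun i => (hYlaw i).aemeasurable, map_normBlockMax hXlaw hXind _ hm ha,
    map_pi_of_iIndepFun (fun i : Fin (n / m) => hYlaw i) (hYind.precomp Fin.val_injective),
    ← frechet_map_boxCox, approxRate_eq _ _ _ hp]
  exact wasserstein₂_map_tupleEmpirical hp hk frechet_pos (incr_measurable μ a m)
    (boxCox_measurable γ) (incr_monotoneOn μ hm0 ha) (boxCox_monotoneOn γ)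

end Main

/-! ### Elementary properties of `boxCox` and of the increments of `V` -/

theorem boxCox_one (γ : ℝ) : boxCox γ 1 = 0 := by
  unfold boxCox
  split_ifs <;> simp

theorem boxCox_mul (γ : ℝ) {x y : ℝ} (hx : 0 < x) (hy : 0 < y) :
    boxCox γ (x * y) = boxCox γ x + x ^ γ * boxCox γ y := by
  unfold boxCox
  split_ifs with h
  · rw [Real.log_mul hx.ne' hy.ne', h]; simp
  · rw [Real.mul_rpow hx.le hy.le]; field_simp; ring

theorem boxCox_continuousAt (γ : ℝ) {x : ℝ} (hx : 0 < x) : ContinuousAt (boxCox γ) x := by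
  unfold boxCox
  split_ifs with h
  · exact Real.continuousAt_log hx.ne'
  · exact ((Real.continuousAt_rpow_const _ _ (Or.inl hx.ne')).sub continuousAt_const).div_const _

theorem boxCox_pos (γ : ℝ) {x : ℝ} (hx : 1 < x) : 0 < boxCox γ x := by
  unfold boxCox
  split_ifs with h
  · exact Real.log_pos hx
  · rcases lt_or_gt_of_ne h with h | h
    · exact div_pos_of_neg_of_neg (sub_neg.mpr (Real.rpow_lt_one_of_one_lt_of_neg hx h)) h
    · exact div_pos (sub_pos.mpr (Real.one_lt_rpow hx h)) h

theorem boxCox_lt {γ x y : ℝ} (hx : 0 < x) (hxy : x < y) : boxCox γ x < boxCox γ y := by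
  have h := boxCox_mul γ hx (div_pos (hx.trans hxy) hx)
  rw [mul_div_cancel₀ _ hx.ne'] at h
  have := mul_pos (Real.rpow_pos_of_pos hx γ) (boxCox_pos γ ((one_lt_div hx).mpr hxy))
  linarith

theorem incr_one (μ : Measure ℝ) (a : ℝ → ℝ) (t : ℝ) : incr μ a t 1 = 0 := by
  simp [incr]

/-- Cocycle identity from splitting V(txy) - V(t) at V(tx); `boxCox_mul` is its limit form. It moves
the base point from t to tx and drives all the growth bounds. -/
theorem incr_mul (μ : Measure ℝ) {a : ℝ → ℝ} {t x : ℝ} (ht : a t ≠ 0) (htx : a (t * x) ≠ 0)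
    (y : ℝ) : incr μ a t (x * y) = incr μ a t x + a (t * x) / a t * incr μ a (t * x) y := by
  unfold incr
  rw [mul_assoc]
  field_simp
  ring

/-- Uniformity in x is free, since tx ≥ t for t ≥ 0 and x ≥ 1. -/
theorem eventually_forall_mul {q : ℝ → Prop} (h : ∀ᶠ t in atTop, q t) :
    ∀ᶠ t in atTop, ∀ x : ℝ, 1 ≤ x → q (t * x) := by
  obtain ⟨t₀, h⟩ := eventually_atTop.mp h
  filter_upwards [eventually_ge_atTop (max t₀ 0)] with t ht x hx
  have h1 := le_max_left t₀ 0
  have h2 := le_max_right t₀ 0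
  exact h _ (by nlinarith)

theorem tailU_mono (μ : Measure ℝ) {s t : ℝ} (hs : 1 < s) (hst : s ≤ t) :
    tailU μ s ≤ tailU μ t := by
  have hs0 : 0 < s := by linarith
  have h1 : 1 / s < 1 := (div_lt_one hs0).mpr hs
  have h2 : 0 < 1 / t := one_div_pos.mpr (by linarith)
  have h3 := one_div_le_one_div_of_le hs0 hst
  exact quantile_mono μ (by linarith) (by linarith) (by linarith)

/-- With the next lemma this is the quantile form of 1 - 1/t ≤ exp(-1/t) ≤ 1 - 1/(t+1); it transfers
the first order condition from U to V. -/
theorem tailU_le_tailV (μ : Measure ℝ) {t : ℝ} (ht : 1 < t) : tailU μ t ≤ tailV μ t := by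
  have ht0 : 0 < t := by linarith
  have h1 : 1 / t < 1 := (div_lt_one ht0).mpr ht
  refine quantile_mono μ (by linarith) (exp_neg_one_div_lt_one ht0) ?_
  have := Real.add_one_le_exp (-1 / t)
  rw [neg_div] at this ⊢
  linarith

theorem tailV_le_tailU (μ : Measure ℝ) {t : ℝ} (ht : 0 < t) : tailV μ t ≤ tailU μ (t + 1) := by
  have h1 : 0 < 1 / (t + 1) := by positivity
  refine quantile_mono μ (Real.exp_pos _) (by linarith) ?_
  have h2 := Real.add_one_le_exp (1 / t)
  have h3 : Real.exp (-1 / t) = (Real.exp (1 / t))⁻¹ := by rw [neg_div, Real.exp_neg]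
  have h4 : 1 - 1 / (t + 1) = (1 / t + 1)⁻¹ := by field_simp; ring
  rw [h3, h4]
  exact inv_anti₀ (by positivity) h2

theorem tendsto_incr {μ : Measure ℝ} {γ : ℝ} {a : ℝ → ℝ} (ha : ∀ t : ℝ, 0 < t → 0 < a t)
    (h : FirstOrderCondition μ γ a) {x : ℝ} (hx : 0 < x) :
    Tendsto (fun t => incr μ a t x) atTop (𝓝 (boxCox γ x)) := by
  -- Centred at U(t), V(tx) lies between U(tx) and U(tx + 1) ≤ U(t(x + δ/2)) for large t, and
  -- continuity of the limit closes the gap. Subtracting the case x = 1 then recentres at V(t).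
  have key : ∀ x : ℝ, 0 < x →
      Tendsto (fun t => (tailV μ (t * x) - tailU μ t) / a t) atTop (𝓝 (boxCox γ x)) := by
    intro x hx
    rw [tendsto_order]
    constructor
    · intro b hb
      filter_upwards [(h x hx).eventually_const_lt hb, eventually_gt_atTop 0,
        eventually_gt_atTop (1 / x)] with t h1 ht htx
      have hat := ha t ht
      have : 1 < t * x := by rwa [div_lt_iff₀ hx] at htx
      have := tailU_le_tailV μ this
      refine h1.trans_le ?_
      gcongr
    · intro b hb
      have hev := (boxCox_continuousAt γ hx).eventually (gt_mem_nhds hb)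
      obtain ⟨δ, hδ, hball⟩ := Metric.eventually_nhds_iff.mp hev
      have hb' : boxCox γ (x + δ / 2) < b := hball (by
        rw [Real.dist_eq, add_sub_cancel_left, abs_of_pos (by positivity)]; linarith)
      filter_upwards [(h (x + δ / 2) (by positivity)).eventually_lt_const hb',
        eventually_gt_atTop 0, eventually_gt_atTop (2 / δ)] with t h1 ht htδ
      have hat := ha t ht
      have h2 : t * x + 1 ≤ t * (x + δ / 2) := by
        rw [div_lt_iff₀ hδ] at htδ
        linarith
      have htx : 0 < t * x := mul_pos ht hx
      have := (tailV_le_tailU μ htx).trans (tailU_mono μ (by linarith) h2)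
      refine lt_of_le_of_lt ?_ h1
      gcongr
  have := (key x hx).sub (key 1 one_pos)
  rw [boxCox_one, sub_zero] at this
  refine this.congr fun t => ?_
  rw [incr, mul_one]
  ring

/-! ### Growth bounds by doubling -/

/-- `f t x = O(x ^ κ)` on `[1, ∞)`, uniformly in large `t`. -/
def GrowthBound (f : ℝ → ℝ → ℝ) (κ : ℝ) : Prop :=
  ∃ C : ℝ, 0 ≤ C ∧ ∀ᶠ t in atTop, ∀ x : ℝ, 1 ≤ x → |f t x| ≤ C * x ^ κ

/-- `f t` is bounded on `[1, 2]`, uniformly in large `t`. -/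
def LocalBound (f : ℝ → ℝ → ℝ) : Prop :=
  ∃ C : ℝ, 0 ≤ C ∧ ∀ᶠ t in atTop, ∀ x ∈ Icc (1 : ℝ) 2, |f t x| ≤ C

/-- Induction over dyadic scales; `hCD'` is exactly what lets the constant `D` survive one doubling.
-/
theorem le_mul_rpow_of_doubling {φ : ℝ → ℝ} {q C κ D : ℝ} (hκ : 0 ≤ κ) (hq : 0 ≤ q) (hD : 0 ≤ D)
    (hCD : C ≤ D) (hCD' : q * D + C ≤ D * 2 ^ κ) (h1 : ∀ x ∈ Icc (1 : ℝ) 2, φ x ≤ C)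
    (h2 : ∀ x, 1 ≤ x → φ (2 * x) ≤ q * φ x + C * x ^ κ) {x : ℝ} (hx : 1 ≤ x) :
    φ x ≤ D * x ^ κ := by
  have key : ∀ n : ℕ, ∀ x : ℝ, 1 ≤ x → x ≤ 2 ^ (n + 1) → φ x ≤ D * x ^ κ := by
    intro n
    induction n with
    | zero =>
      intro x hx hx2
      have := Real.one_le_rpow hx hκ
      have := h1 x ⟨hx, by simpa using hx2⟩
      nlinarith
    | succ n ih =>
      intro x hx hx2
      rcases le_or_gt x 2 with h | h
      · have := Real.one_le_rpow hx hκ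
        have := h1 x ⟨hx, h⟩
        nlinarith
      · have hy : 1 ≤ x / 2 := by linarith
        have hyn : x / 2 ≤ 2 ^ (n + 1) := by rw [pow_succ] at hx2; linarith
        have e1 := ih (x / 2) hy hyn
        have e2 := h2 (x / 2) hy
        have hxe : 2 * (x / 2) = x := by ring
        have e3 : x ^ κ = 2 ^ κ * (x / 2) ^ κ := by
          rw [← Real.mul_rpow (by norm_num) (by linarith), hxe]
        rw [hxe] at e2
        have hp := Real.rpow_pos_of_pos (show 0 < x / 2 by linarith) κ
        have e4 := mul_le_mul_of_nonneg_left e1 hq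
        have e5 := mul_le_mul_of_nonneg_right hCD' hp.le
        rw [e3]
        linarith
  obtain ⟨n, hn⟩ := pow_unbounded_of_one_lt x (one_lt_two : (1 : ℝ) < 2)
  exact key n x hx (hn.le.trans (pow_le_pow_right₀ one_le_two (by omega)))

theorem GrowthBound.of_doubling {f : ℝ → ℝ → ℝ} {κ q C : ℝ} (hκ : 0 ≤ κ) (hq : 0 ≤ q)
    (hqκ : q < 2 ^ κ) (h1 : LocalBound f)
    (h2 : ∀ᶠ t in atTop, ∀ x : ℝ, 1 ≤ x → |f t (2 * x)| ≤ q * |f t x| + C * x ^ κ) :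
    GrowthBound f κ := by
  obtain ⟨C', hC', h1⟩ := h1
  -- One constant serves both for [1, 2] and for the doubling error. The final `D` then has D(2^κ -
  -- q) ≥ M, which is the closing condition of the induction.
  set M := max C C' with hM
  have hM0 : 0 ≤ M := hC'.trans (le_max_right _ _)
  have hd : 0 < 2 ^ κ - q := by linarith
  have hD1 : M ≤ max M (M / (2 ^ κ - q)) := le_max_left _ _
  have hD2 : M ≤ max M (M / (2 ^ κ - q)) * (2 ^ κ - q) := by
    have := le_max_right M (M / (2 ^ κ - q))
    rwa [div_le_iff₀ hd] at this
  refine ⟨max M (M / (2 ^ κ - q)), hM0.trans hD1, ?_⟩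
  filter_upwards [h1, h2] with t h1 h2 x hx
  refine le_mul_rpow_of_doubling (φ := fun x => |f t x|) (C := M) hκ hq (hM0.trans hD1) hD1
    (by linarith) (fun x hx => (h1 x hx).trans (le_max_right _ _)) (fun x hx => ?_) hx
  have := Real.rpow_pos_of_pos (show 0 < x by linarith) κ
  have := mul_le_mul_of_nonneg_right (le_max_left C C') this.le
  linarith [h2 x hx]

theorem GrowthBound.of_mul {f : ℝ → ℝ → ℝ} {κ l : ℝ} (hκ : 0 ≤ κ) (hl : |l| < 2 ^ κ)
    (h1 : LocalBound f) (hlim : Tendsto (fun t => f t 2) atTop (𝓝 l))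
    (hmul : ∀ᶠ t in atTop, ∀ x : ℝ, 1 ≤ x → f t (2 * x) = f t x * f (t * x) 2) :
    GrowthBound f κ := by
  obtain ⟨q, hq1, hq2⟩ := exists_between hl
  refine GrowthBound.of_doubling (C := 0) hκ ((abs_nonneg l).trans hq1.le) hq2 h1 ?_
  filter_upwards [hmul, eventually_forall_mul (hlim.abs.eventually_lt_const hq1)] with t h2 h3 x hx
  rw [h2 x hx, abs_mul, zero_mul, add_zero, mul_comm]
  exact mul_le_mul_of_nonneg_right (h3 x hx).le (abs_nonneg _)

theorem LocalBound.mul {f g : ℝ → ℝ → ℝ} (hf : LocalBound f) (hg : LocalBound g) :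
    LocalBound fun t x => f t x * g t x := by
  obtain ⟨C, hC, hf⟩ := hf
  obtain ⟨D, hD, hg⟩ := hg
  refine ⟨C * D, by positivity, ?_⟩
  filter_upwards [hf, hg] with t hf hg x hx
  rw [abs_mul]
  exact mul_le_mul (hf x hx) (hg x hx) (abs_nonneg _) hC

/-! ### First order bounds -/

section FirstOrder

variable {μ : Measure ℝ} {γ : ℝ} {a : ℝ → ℝ}

/-- The cocycle identity expresses the ratio as (incr t (2x) - incr t x)/incr (tx) 2, so regular
variation of `a` is a consequence, not an assumption. -/
theorem tendsto_ratio (ha : ∀ t : ℝ, 0 < t → 0 < a t)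
    (h : ∀ x : ℝ, 0 < x → Tendsto (fun t => incr μ a t x) atTop (𝓝 (boxCox γ x)))
    {x : ℝ} (hx : 0 < x) : Tendsto (fun t => a (t * x) / a t) atTop (𝓝 (x ^ γ)) := by
  have hb : 0 < boxCox γ 2 := boxCox_pos γ one_lt_two
  have hsub : Tendsto (fun t => incr μ a (t * x) 2) atTop (𝓝 (boxCox γ 2)) :=
    (h 2 two_pos).comp (tendsto_id.atTop_mul_const hx)
  have := ((h (x * 2) (by positivity)).sub (h x hx)).div hsub hb.ne'
  rw [boxCox_mul γ hx two_pos, add_sub_cancel_left, mul_div_cancel_right₀ _ hb.ne'] at this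
  refine this.congr' ?_
  filter_upwards [eventually_gt_atTop 0, hsub.eventually_const_lt hb] with t ht hpos
  simp only [Pi.div_apply]
  rw [incr_mul μ (ha t ht).ne' (ha _ (mul_pos ht hx)).ne', add_sub_cancel_left,
    mul_div_cancel_right₀ _ hpos.ne']

/-- Monotonicity of V replaces measurability of `a`: the ratio times incr (tx) 2 is at most incr t
4, and incr (tx) 2 stays away from 0. -/
theorem ratio_localBound (ha : ∀ t : ℝ, 0 < t → 0 < a t)
    (h : ∀ x : ℝ, 0 < x → Tendsto (fun t => incr μ a t x) atTop (𝓝 (boxCox γ x))) :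
    LocalBound fun t x => a (t * x) / a t := by
  have hb : 0 < boxCox γ 2 := boxCox_pos γ one_lt_two
  have h4 : 0 < boxCox γ 4 := boxCox_pos γ (by norm_num)
  refine ⟨(boxCox γ 4 + 1) / (boxCox γ 2 / 2), by positivity, ?_⟩
  filter_upwards [eventually_gt_atTop 0,
    eventually_forall_mul ((h 2 two_pos).eventually_const_lt (half_lt_self hb)),
    (h 4 (by norm_num)).eventually_lt_const (lt_add_one _)] with t ht h2 h4 x hx
  have hx0 : 0 < x := by linarith [hx.1]
  have hat := ha t ht
  have hatx := ha _ (mul_pos ht hx0)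
  have hm := incr_monotoneOn μ ht hat
  rw [abs_of_pos (div_pos hatx hat), le_div_iff₀ (by positivity)]
  have e1 := incr_mul μ hat.ne' hatx.ne' 2
  have e2 : incr μ a t (x * 2) ≤ incr μ a t 4 :=
    hm (show 0 < x * 2 by positivity) (show (0 : ℝ) < 4 by norm_num) (by linarith [hx.2])
  have e3 : incr μ a t 1 ≤ incr μ a t x := hm (show (0 : ℝ) < 1 by norm_num) hx0 hx.1
  rw [incr_one] at e3
  have e4 := mul_le_mul_of_nonneg_left (h2 x hx.1).le (div_pos hatx hat).le
  linarith

/-- For x in [1, 2], [t, 2t] lies inside [tx/2, 2tx], so an increment of order a(t) is dominated by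
one of order a(tx). -/
theorem ratio_inv_localBound (ha : ∀ t : ℝ, 0 < t → 0 < a t)
    (h : ∀ x : ℝ, 0 < x → Tendsto (fun t => incr μ a t x) atTop (𝓝 (boxCox γ x))) :
    LocalBound fun t x => (a (t * x) / a t)⁻¹ := by
  have hb : 0 < boxCox γ 2 := boxCox_pos γ one_lt_two
  have hh : boxCox γ (1 / 2) < 0 := by
    rw [← boxCox_one γ]; exact boxCox_lt (by norm_num) (by norm_num)
  refine ⟨(boxCox γ 2 + 1 - (boxCox γ (1 / 2) - 1)) / (boxCox γ 2 / 2),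
    div_nonneg (by linarith) (by linarith), ?_⟩
  filter_upwards [eventually_gt_atTop 0, (h 2 two_pos).eventually_const_lt (half_lt_self hb),
    eventually_forall_mul ((h 2 two_pos).eventually_lt_const (lt_add_one _)),
    eventually_forall_mul ((h (1 / 2) (by norm_num)).eventually_const_lt (sub_one_lt _))]
    with t ht h1 h2 h3 x hx
  have hx0 : 0 < x := by linarith [hx.1]
  have hat := ha t ht
  have hatx := ha _ (mul_pos ht hx0)
  have htx := mul_pos ht hx0
  have hV := tailV_monotoneOn μ
  rw [inv_div, abs_of_pos (div_pos hat hatx), div_le_div_iff₀ hatx (by positivity)]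
  have e1 : tailV μ (t * 2) ≤ tailV μ (t * x * 2) :=
    hV (show 0 < t * 2 by positivity) (show 0 < t * x * 2 by positivity) (by nlinarith [hx.1])
  have e2 : tailV μ (t * x * (1 / 2)) ≤ tailV μ t :=
    hV (show 0 < t * x * (1 / 2) by positivity) ht (by nlinarith [hx.2])
  have h1' : boxCox γ 2 / 2 * a t < tailV μ (t * 2) - tailV μ t := (lt_div_iff₀ hat).mp h1
  have h2' : tailV μ (t * x * 2) - tailV μ (t * x) < (boxCox γ 2 + 1) * a (t * x) :=
    (div_lt_iff₀ hatx).mp (h2 x hx.1)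
  have h3' : (boxCox γ (1 / 2) - 1) * a (t * x)
      < tailV μ (t * x * (1 / 2)) - tailV μ (t * x) := (lt_div_iff₀ hatx).mp (h3 x hx.1)
  linarith

theorem ratio_growthBound (ha : ∀ t : ℝ, 0 < t → 0 < a t)
    (h : ∀ x : ℝ, 0 < x → Tendsto (fun t => incr μ a t x) atTop (𝓝 (boxCox γ x)))
    {κ : ℝ} (hκ : 0 ≤ κ) (hγκ : γ < κ) : GrowthBound (fun t x => a (t * x) / a t) κ := by
  refine GrowthBound.of_mul hκ ?_ (ratio_localBound ha h) (tendsto_ratio ha h two_pos) ?_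
  · rw [abs_of_pos (by positivity)]
    exact Real.rpow_lt_rpow_of_exponent_lt one_lt_two hγκ
  · filter_upwards [eventually_gt_atTop 0] with t ht x hx
    have := ha _ (mul_pos ht (by linarith : 0 < x))
    have := ha t ht
    rw [mul_comm 2 x, ← mul_assoc]
    field_simp

theorem ratio_inv_growthBound (ha : ∀ t : ℝ, 0 < t → 0 < a t)
    (h : ∀ x : ℝ, 0 < x → Tendsto (fun t => incr μ a t x) atTop (𝓝 (boxCox γ x)))
    {κ : ℝ} (hκ : 0 ≤ κ) (hγκ : -γ < κ) : GrowthBound (fun t x => (a (t * x) / a t)⁻¹) κ := by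
  refine GrowthBound.of_mul hκ ?_ (ratio_inv_localBound ha h)
    ((tendsto_ratio ha h two_pos).inv₀ (by positivity)) ?_
  · rw [abs_of_pos (by positivity), ← Real.rpow_neg (by norm_num)]
    exact Real.rpow_lt_rpow_of_exponent_lt one_lt_two hγκ
  · filter_upwards [eventually_gt_atTop 0] with t ht x hx
    have := ha _ (mul_pos ht (by linarith : 0 < x))
    have := ha t ht
    rw [mul_comm 2 x, ← mul_assoc]
    field_simp

theorem incr_growthBound (ha : ∀ t : ℝ, 0 < t → 0 < a t)
    (h : ∀ x : ℝ, 0 < x → Tendsto (fun t => incr μ a t x) atTop (𝓝 (boxCox γ x)))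
    {κ : ℝ} (hκ : 0 < κ) (hγκ : γ < κ) : GrowthBound (incr μ a) κ := by
  have hb : 0 < boxCox γ 2 := boxCox_pos γ one_lt_two
  obtain ⟨C, hC, hα⟩ := ratio_growthBound ha h hκ.le hγκ
  have hpos : ∀ᶠ t in atTop, 0 < incr μ a t 2 := (h 2 two_pos).eventually_const_lt hb
  have hle := (h 2 two_pos).eventually_lt_const (lt_add_one _)
  refine GrowthBound.of_doubling (q := 1) (C := C * (boxCox γ 2 + 1)) hκ.le zero_le_one
    (Real.one_lt_rpow one_lt_two hκ) ⟨boxCox γ 2 + 1, by positivity, ?_⟩ ?_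
  · filter_upwards [eventually_gt_atTop 0, hle] with t ht h2 x hx
    have hx0 : 0 < x := by linarith [hx.1]
    have hm := incr_monotoneOn μ ht (ha t ht)
    have e1 : incr μ a t x ≤ incr μ a t 2 := hm hx0 (show (0 : ℝ) < 2 by norm_num) hx.2
    have e2 : incr μ a t 1 ≤ incr μ a t x := hm (show (0 : ℝ) < 1 by norm_num) hx0 hx.1
    rw [incr_one] at e2
    rw [abs_of_nonneg e2]
    linarith
  · filter_upwards [eventually_gt_atTop 0, hα, eventually_forall_mul hle,
      eventually_forall_mul hpos] with t ht hα h2 hp x hx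
    have hx0 : 0 < x := by linarith
    rw [mul_comm 2 x, incr_mul μ (ha t ht).ne' (ha _ (mul_pos ht hx0)).ne', one_mul]
    refine (abs_add_le _ _).trans (add_le_add_right ?_ _)
    rw [abs_mul, abs_of_pos (hp x hx)]
    calc _ ≤ C * x ^ κ * (boxCox γ 2 + 1) :=
          mul_le_mul (hα x hx) (h2 x hx).le (hp x hx).le (by positivity)
      _ = _ := by ring

/-- `f t z = O(z ^ (-K))` on `(0, 1]` for some `K`, uniformly in large `t`. -/
def SmallBound (f : ℝ → ℝ → ℝ) : Prop :=
  ∃ C K : ℝ, 0 ≤ C ∧ 0 ≤ K ∧ ∀ᶠ t in atTop, ∀ z : ℝ, 0 < z → z ≤ 1 → |f t z| ≤ C * z ^ (-K)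

theorem tailV_ge_of_finiteLeftEndpoint (hL : FiniteLeftEndpoint μ) :
    ∃ L, ∀ t, 0 < t → L ≤ tailV μ t := by
  obtain ⟨L, hL⟩ := hL
  refine ⟨L, fun t ht => ?_⟩
  have := (tailV_le_iff μ ht (tailV μ t)).mp le_rfl
  exact hL ((Real.exp_pos _).trans_le this)

theorem incr_smallBound (ha : ∀ t : ℝ, 0 < t → 0 < a t)
    (h : ∀ x : ℝ, 0 < x → Tendsto (fun t => incr μ a t x) atTop (𝓝 (boxCox γ x)))
    (hL : FiniteLeftEndpoint μ) : SmallBound (incr μ a) := by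
  obtain ⟨L, hL⟩ := tailV_ge_of_finiteLeftEndpoint hL
  set κ := |γ| + 1 with hκ
  have hκ0 : 0 < κ := by positivity
  obtain ⟨C₁, hC₁, h₁⟩ := ratio_inv_growthBound ha h hκ0.le (by linarith [neg_le_abs γ])
  obtain ⟨C₂, hC₂, h₂⟩ := incr_growthBound ha h hκ0 (by linarith [le_abs_self γ])
  obtain ⟨t₀, h₀⟩ := eventually_atTop.mp ((h₁.and h₂).and (eventually_gt_atTop 0))
  have ht₀ : 0 < t₀ := (h₀ t₀ le_rfl).2
  set E := (tailV μ t₀ - L) / a t₀ with hE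
  have hE0 : 0 ≤ E := div_nonneg (sub_nonneg.mpr (hL t₀ ht₀)) (ha t₀ ht₀).le
  refine ⟨C₁ * (C₂ + E), κ + κ, by positivity, by positivity, ?_⟩
  filter_upwards [eventually_ge_atTop t₀] with t htt z hz hz1
  have ht : 0 < t := ht₀.trans_le htt
  have hx1 : 1 ≤ z⁻¹ := (one_le_inv₀ hz).mpr hz1
  have hzK : z ^ (-(κ + κ)) = (z⁻¹) ^ κ * (z⁻¹) ^ κ := by
    rw [← Real.rpow_add (inv_pos.mpr hz), Real.inv_rpow hz.le, Real.rpow_neg hz.le]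
  have hzκ : 1 ≤ (z⁻¹) ^ κ := Real.one_le_rpow hx1 hκ0.le
  rw [hzK]
  -- If tz is large, the cocycle from base tz with factor 1/z leads back to t, and both factors grow
  -- polynomially in 1/z. Otherwise V(tz) is bounded below by the left endpoint, and t/t₀ < 1/z
  -- turns growth in t into a power of 1/z.
  rcases le_or_gt t₀ (t * z) with hc | hc
  · have hs := h₀ (t * z) hc
    have hst : t * z * z⁻¹ = t := mul_inv_cancel_right₀ hz.ne' t
    have has := ha _ hs.2
    have hat := ha t ht
    have e := incr_mul μ (a := a) (t := t * z) (x := z⁻¹) has.ne' (by rw [hst]; exact hat.ne') z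
    rw [inv_mul_cancel₀ hz.ne', incr_one, hst] at e
    have e1 : incr μ a t z = -((a t / a (t * z))⁻¹ * incr μ a (t * z) z⁻¹) := by
      have hr : a t / a (t * z) ≠ 0 := (div_pos hat has).ne'
      rw [eq_neg_iff_add_eq_zero]
      calc _ = (a t / a (t * z))⁻¹ *
            (incr μ a (t * z) z⁻¹ + a t / a (t * z) * incr μ a t z) := by
            rw [mul_add, inv_mul_cancel_left₀ hr]; ring
        _ = 0 := by rw [← e, mul_zero]
    have b1 := hs.1.1 z⁻¹ hx1
    have b2 := hs.1.2 z⁻¹ hx1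
    beta_reduce at b1
    rw [hst] at b1
    rw [e1, abs_neg, abs_mul]
    calc _ ≤ (C₁ * z⁻¹ ^ κ) * (C₂ * z⁻¹ ^ κ) :=
          mul_le_mul b1 b2 (abs_nonneg _) (by positivity)
      _ = C₁ * C₂ * (z⁻¹ ^ κ * z⁻¹ ^ κ) := by ring
      _ ≤ _ := by gcongr; linarith
  · have hx0 : 1 ≤ t / t₀ := (one_le_div ht₀).mpr htt
    have hx0z : t / t₀ ≤ z⁻¹ := by
      rw [div_le_iff₀ ht₀, ← div_eq_inv_mul, le_div_iff₀ hz]; exact hc.le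
    have hte : t₀ * (t / t₀) = t := mul_div_cancel₀ _ ht₀.ne'
    have hat := ha t ht
    have ha0 := ha t₀ ht₀
    have b1 := (h₀ t₀ le_rfl).1.1 (t / t₀) hx0
    have b2 := (h₀ t₀ le_rfl).1.2 (t / t₀) hx0
    beta_reduce at b1
    rw [hte] at b1
    have b3 : (t / t₀) ^ κ ≤ z⁻¹ ^ κ := Real.rpow_le_rpow (by positivity) hx0z hκ0.le
    have c1 : L ≤ tailV μ (t * z) := hL _ (mul_pos ht hz)
    have c2 : tailV μ (t * z) ≤ tailV μ t :=
      tailV_monotoneOn μ (mul_pos ht hz) ht (by nlinarith)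
    have c3 : |incr μ a t z| ≤ (tailV μ t - L) / a t := by
      rw [incr, abs_div, abs_of_pos hat]
      gcongr
      rw [abs_of_nonpos (by linarith)]
      linarith
    have c4 : (tailV μ t - L) / a t = (a t / a t₀)⁻¹ * (incr μ a t₀ (t / t₀) + E) := by
      rw [incr, hte, hE]
      field_simp
      ring
    rw [c4] at c3
    have d1 : (a t / a t₀)⁻¹ ≤ C₁ * z⁻¹ ^ κ :=
      (le_abs_self _).trans (b1.trans (by gcongr))
    have d2 : incr μ a t₀ (t / t₀) + E ≤ (C₂ + E) * z⁻¹ ^ κ := by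
      have := (le_abs_self _).trans (b2.trans (by gcongr : _ ≤ C₂ * z⁻¹ ^ κ))
      nlinarith
    calc _ ≤ _ := c3
      _ ≤ (a t / a t₀)⁻¹ * ((C₂ + E) * z⁻¹ ^ κ) := by gcongr
      _ ≤ (C₁ * z⁻¹ ^ κ) * ((C₂ + E) * z⁻¹ ^ κ) := by gcongr
      _ = _ := by ring

end FirstOrder

/-! ### Local uniform bounds from measurability -/

/-- Passing to sequences makes convergence in measure available. -/
theorem localBound_of_seq {f : ℝ → ℝ → ℝ}
    (h : ∀ t w : ℕ → ℝ, Tendsto t atTop atTop → (∀ n, 0 < t n) → (∀ n, w n ∈ Icc (1 : ℝ) 2) →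
      ∃ C, ∀ᶠ n in atTop, |f (t n) (w n)| ≤ C) : LocalBound f := by
  by_contra hc
  have key : ∀ n : ℕ, ∃ t w : ℝ, (n : ℝ) + 1 ≤ t ∧ w ∈ Icc (1 : ℝ) 2 ∧ (n : ℝ) < |f t w| := by
    intro n
    by_contra hn
    push Not at hn
    exact hc ⟨n, Nat.cast_nonneg n, by
      filter_upwards [eventually_ge_atTop ((n : ℝ) + 1)] with t ht w hw using hn t w ht hw⟩
  choose t w ht hw hlt using key
  have htop : Tendsto t atTop atTop :=
    tendsto_atTop_mono (fun n => (by linarith [ht n] : (n : ℝ) ≤ t n)) tendsto_natCast_atTop_atTop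
  obtain ⟨C, hC⟩ := h t w htop (fun n => by linarith [ht n, (Nat.cast_nonneg n : (0 : ℝ) ≤ n)]) hw
  obtain ⟨n, h1, h2⟩ := (hC.and (tendsto_natCast_atTop_atTop.eventually_ge_atTop C)).exists
  linarith [hlt n]

theorem eventually_volume_setOf_lt {f : ℕ → ℝ → ℝ} {F : ℝ → ℝ}
    (hf : ∀ n, AEMeasurable (f n) (volume.restrict (Icc 1 8)))
    (hlim : ∀ x ∈ Icc (1 : ℝ) 8, Tendsto (fun n => f n x) atTop (𝓝 (F x)))
    {M : ℝ} (hM : ∀ x ∈ Icc (1 : ℝ) 8, |F x| ≤ M) :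
    ∀ᶠ n in atTop, volume ({x | M + 1 < |f n x|} ∩ Icc 1 8) < 1 / 4 := by
  have hT : TendstoInMeasure (volume.restrict (Icc (1 : ℝ) 8)) f atTop F :=
    tendstoInMeasure_of_tendsto_ae (fun n => (hf n).aestronglyMeasurable)
      ((ae_restrict_iff' measurableSet_Icc).mpr (ae_of_all _ hlim))
  filter_upwards [(hT 1 one_pos).eventually_lt_const (show (0 : ℝ≥0∞) < 1 / 4 by simp)] with n hn
  refine lt_of_le_of_lt ?_ hn
  refine le_trans (measure_mono ?_) (Measure.le_restrict_apply _ _)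
  rintro x ⟨hx, hxI⟩
  refine ⟨?_, hxI⟩
  have h1 : M + 1 < |f n x| := hx
  have h2 := hM x hxI
  have h3 := abs_sub_abs_le_abs_sub (f n x) (F x)
  change 1 ≤ edist (f n x) (F x)
  rw [edist_dist, Real.dist_eq, ENNReal.one_le_ofReal]
  linarith

/-- Pigeonhole in measure: the bad sets have measure below 1/4, and pulling one back by the dilation
w ≥ 1 does not enlarge it, so they cannot cover an interval of length 1. The range [1, 8] contains
wy for w ≤ 2 and y ≤ 4. The constant is chosen before b, so several intervals can share it. -/
theorem exists_good_point {f g : ℕ → ℝ → ℝ} {F G : ℝ → ℝ} {w : ℕ → ℝ}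
    (hw : ∀ n, w n ∈ Icc (1 : ℝ) 2)
    (hf : ∀ n, AEMeasurable (f n) (volume.restrict (Icc 1 8)))
    (hg : ∀ n, AEMeasurable (g n) (volume.restrict (Icc 1 8)))
    (hfF : ∀ x ∈ Icc (1 : ℝ) 8, Tendsto (fun n => f n x) atTop (𝓝 (F x)))
    (hgG : ∀ x ∈ Icc (1 : ℝ) 8, Tendsto (fun n => g n x) atTop (𝓝 (G x)))
    (hF : ContinuousOn F (Icc 1 8)) (hG : ContinuousOn G (Icc 1 8)) :
    ∃ C, ∀ b ∈ Icc (1 : ℝ) 3, ∀ᶠ n in atTop, ∃ y ∈ Icc b (b + 1),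
      |f n (w n * y)| ≤ C ∧ |g n y| ≤ C := by
  obtain ⟨M₁, hM₁⟩ := isCompact_Icc.exists_bound_of_continuousOn hF
  obtain ⟨M₂, hM₂⟩ := isCompact_Icc.exists_bound_of_continuousOn hG
  simp only [Real.norm_eq_abs] at hM₁ hM₂
  refine ⟨max M₁ M₂ + 1, fun b hb => ?_⟩
  filter_upwards [eventually_volume_setOf_lt hf hfF fun x hx => (hM₁ x hx).trans (le_max_left _ M₂),
    eventually_volume_setOf_lt hg hgG fun x hx => (hM₂ x hx).trans (le_max_right M₁ _)]
    with n h1 h2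
  by_contra hc
  push Not at hc
  have hw0 : 0 < w n := by linarith [(hw n).1]
  set S := {x | max M₁ M₂ + 1 < |f n x|} ∩ Icc (1 : ℝ) 8
  set T := {x | max M₁ M₂ + 1 < |g n x|} ∩ Icc (1 : ℝ) 8
  have hsub : Icc b (b + 1) ⊆ ((w n * ·) ⁻¹' S) ∪ T := by
    intro y hy
    have hy8 : y ∈ Icc (1 : ℝ) 8 := ⟨hb.1.trans hy.1, by linarith [hy.2, hb.2]⟩
    rcases le_or_gt (|f n (w n * y)|) (max M₁ M₂ + 1) with h | h
    · exact Or.inr ⟨hc y hy h, hy8⟩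
    · refine Or.inl ⟨h, ?_, ?_⟩
      · nlinarith [(hw n).1, hy8.1]
      · have := hy.2
        have := hb.2
        nlinarith [(hw n).2, hy8.1]
  have h3 : volume ((w n * ·) ⁻¹' S) ≤ volume S := by
    rw [Real.volume_preimage_mul_left hw0.ne', abs_of_pos (inv_pos.mpr hw0)]
    refine mul_le_of_le_one_left' ?_
    rw [← ENNReal.ofReal_one]
    exact ENNReal.ofReal_le_ofReal (inv_le_one_of_one_le₀ (hw n).1)
  have h4 : (1 : ℝ≥0∞) ≤ volume S + volume T := by
    calc (1 : ℝ≥0∞) = volume (Icc b (b + 1)) := by rw [Real.volume_Icc]; simp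
      _ ≤ _ := (measure_mono hsub).trans (measure_union_le _ _)
      _ ≤ _ := add_le_add_left h3 _
  have h5 : volume S + volume T < 1 / 4 + 1 / 4 := ENNReal.add_lt_add h1 h2
  have h6 : (1 / 4 + 1 / 4 : ℝ≥0∞) ≤ 1 := by
    rw [← two_mul, ← mul_div_assoc, mul_one]
    exact ENNReal.div_le_of_le_mul (by norm_num)
  exact absurd (h4.trans_lt h5) (not_lt.mpr h6)

theorem aemeasurable_comp_mul_left {A : ℝ → ℝ} (hA : AEMeasurable A (volume.restrict (Ioi 0)))
    {t : ℝ} (ht : 0 < t) : AEMeasurable (fun x => A (t * x)) (volume.restrict (Icc 1 8)) := by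
  refine hA.comp_quasiMeasurePreserving (f := (t * ·)) ⟨measurable_const_mul t, ?_⟩
  refine Measure.AbsolutelyContinuous.mk fun s hs h0 => ?_
  rw [Measure.restrict_apply hs] at h0
  rw [Measure.map_apply (measurable_const_mul t) hs,
    Measure.restrict_apply (measurable_const_mul t hs)]
  refine measure_mono_null (t := (t * ·) ⁻¹' (s ∩ Ioi 0)) ?_ ?_
  · rintro x ⟨hx, hx1⟩
    exact ⟨hx, mul_pos ht (by linarith [hx1.1])⟩
  · rw [Real.volume_preimage_mul_left ht.ne', h0, mul_zero]

/-! ### Regularly varying functions -/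

theorem IsRegularlyVarying.eventually_ne {A : ℝ → ℝ} {ρ : ℝ} (h : IsRegularlyVarying A ρ) :
    ∀ᶠ t in atTop, A t ≠ 0 := by
  rcases h.eventually_sign with h | h
  · exact h.mono fun t ht => ht.ne'
  · exact h.mono fun t ht => ht.ne

/-- A boundedness version of the uniform convergence theorem: with a good y, the value at w is the
difference of the values at wy from base t and at y from base tw. `Real.log` sees only absolute
values, so the sign of `A` is harmless. -/
theorem IsRegularlyVarying.log_localBound {A : ℝ → ℝ} {ρ : ℝ} (h : IsRegularlyVarying A ρ) :
    LocalBound fun t x => Real.log (A (t * x) / A t) := by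
  refine localBound_of_seq fun t w ht ht0 hw => ?_
  have hw0 : ∀ n, 0 < w n := fun n => by linarith [(hw n).1]
  have htw : Tendsto (fun n => t n * w n) atTop atTop :=
    tendsto_atTop_mono (fun n => by nlinarith [(hw n).1, ht0 n]) ht
  have hmeas : ∀ s : ℝ, 0 < s →
      AEMeasurable (fun x => Real.log (A (s * x) / A s)) (volume.restrict (Icc 1 8)) := fun s hs =>
    Real.measurable_log.comp_aemeasurable
      ((aemeasurable_comp_mul_left h.aemeasurable hs).div_const _)
  have hlim : ∀ x ∈ Icc (1 : ℝ) 8,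
      Tendsto (fun s => Real.log (A (s * x) / A s)) atTop (𝓝 (Real.log (x ^ ρ))) := by
    intro x hx
    have hx0 : 0 < x := by linarith [hx.1]
    exact (Real.continuousAt_log (Real.rpow_pos_of_pos hx0 ρ).ne').tendsto.comp
      (h.tendsto_ratio x hx0)
  have hcont : ContinuousOn (fun x : ℝ => Real.log (x ^ ρ)) (Icc 1 8) := by
    intro x hx
    have hx0 : 0 < x := by linarith [hx.1]
    exact ((Real.continuousAt_log (Real.rpow_pos_of_pos hx0 ρ).ne').comp (f := fun x : ℝ => x ^ ρ)
      (Real.continuousAt_rpow_const _ _ (Or.inl hx0.ne'))).continuousWithinAt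
  obtain ⟨C, hC⟩ := exists_good_point hw (fun n => hmeas (t n) (ht0 n))
    (fun n => hmeas (t n * w n) (mul_pos (ht0 n) (hw0 n))) (fun x hx => (hlim x hx).comp ht)
    (fun x hx => (hlim x hx).comp htw) hcont hcont
  refine ⟨C + C, ?_⟩
  have hne := eventually_forall_mul h.eventually_ne
  filter_upwards [hC 1 ⟨le_rfl, by norm_num⟩, ht.eventually hne] with n hn hne
  obtain ⟨y, hy, h1, h2⟩ := hn
  have n1 : A (t n) ≠ 0 := by simpa using hne 1 le_rfl
  have n2 : A (t n * w n) ≠ 0 := hne _ (hw n).1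
  have n3 : A (t n * w n * y) ≠ 0 := by
    rw [mul_assoc]; exact hne _ (by nlinarith [(hw n).1, hy.1])
  have e : Real.log (A (t n * w n) / A (t n)) = Real.log (A (t n * (w n * y)) / A (t n))
      - Real.log (A (t n * w n * y) / A (t n * w n)) := by
    rw [← mul_assoc, Real.log_div n2 n1, Real.log_div n3 n1, Real.log_div n3 n2]
    ring
  rw [e]
  exact (abs_sub _ _).trans (add_le_add h1 h2)

theorem IsRegularlyVarying.ratio_localBound {A : ℝ → ℝ} {ρ : ℝ} (h : IsRegularlyVarying A ρ) :
    LocalBound fun t x => A (t * x) / A t := by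
  obtain ⟨C, -, hC⟩ := h.log_localBound
  refine ⟨Real.exp C, (Real.exp_pos _).le, ?_⟩
  filter_upwards [hC, eventually_forall_mul h.eventually_ne] with t ht hne x hx
  have n1 : A t ≠ 0 := by simpa using hne 1 le_rfl
  have hn : A (t * x) / A t ≠ 0 := div_ne_zero (hne _ hx.1) n1
  rw [← Real.exp_log (abs_pos.mpr hn), Real.log_abs, Real.exp_le_exp]
  exact (le_abs_self _).trans (ht x hx)

theorem IsRegularlyVarying.ratio_inv_localBound {A : ℝ → ℝ} {ρ : ℝ} (h : IsRegularlyVarying A ρ) :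
    LocalBound fun t x => (A (t * x) / A t)⁻¹ := by
  obtain ⟨C, -, hC⟩ := h.log_localBound
  refine ⟨Real.exp C, (Real.exp_pos _).le, ?_⟩
  filter_upwards [hC, eventually_forall_mul h.eventually_ne] with t ht hne x hx
  have n1 : A t ≠ 0 := by simpa using hne 1 le_rfl
  have hn : (A (t * x) / A t)⁻¹ ≠ 0 := inv_ne_zero (div_ne_zero (hne _ hx.1) n1)
  rw [← Real.exp_log (abs_pos.mpr hn), Real.log_abs, Real.log_inv, Real.exp_le_exp]
  exact (neg_le_abs _).trans (ht x hx)

theorem IsRegularlyVarying.ratio_inv_growthBound {A : ℝ → ℝ} {ρ : ℝ} (h : IsRegularlyVarying A ρ)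
    {κ : ℝ} (hκ : 0 ≤ κ) (hρκ : -ρ < κ) : GrowthBound (fun t x => (A (t * x) / A t)⁻¹) κ := by
  refine GrowthBound.of_mul hκ ?_ h.ratio_inv_localBound
    ((h.tendsto_ratio 2 two_pos).inv₀ (by positivity)) ?_
  · rw [abs_of_pos (by positivity), ← Real.rpow_neg (by norm_num)]
    exact Real.rpow_lt_rpow_of_exponent_lt one_lt_two hρκ
  · filter_upwards [eventually_forall_mul h.eventually_ne] with t hne x hx
    have n1 : A t ≠ 0 := by simpa using hne 1 le_rfl
    have n2 := hne _ hx
    rw [mul_comm 2 x, ← mul_assoc]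
    field_simp

/-! ### Second order bounds -/

/-- The normalized second order remainder of the increments of `V`. -/
def remIncr (μ : Measure ℝ) (γ : ℝ) (a A : ℝ → ℝ) (t x : ℝ) : ℝ :=
  (incr μ a t x - boxCox γ x) / A t

/-- The normalized second order remainder of the ratios of `a`. -/
def remRatio (γ : ℝ) (a A : ℝ → ℝ) (t x : ℝ) : ℝ := (a (t * x) / a t - x ^ γ) / A t

/-- The ratio of the products of the normalizing functions. -/
def prodRatio (a A : ℝ → ℝ) (t x : ℝ) : ℝ := a (t * x) / a t * (A (t * x) / A t)

/-- Difference of `incr_mul` and `boxCox_mul`. The middle term shows that the remainder of `a` must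
be controlled along with that of V. -/
theorem remIncr_mul (μ : Measure ℝ) (γ : ℝ) {a A : ℝ → ℝ} {t x y : ℝ} (hx : 0 < x) (hy : 0 < y)
    (ht : a t ≠ 0) (htx : a (t * x) ≠ 0) (hA : A t ≠ 0) (hAx : A (t * x) ≠ 0) :
    remIncr μ γ a A t (x * y) = remIncr μ γ a A t x + remRatio γ a A t x * boxCox γ y
      + prodRatio a A t x * remIncr μ γ a A (t * x) y := by
  unfold remIncr remRatio prodRatio
  rw [incr_mul μ ht htx, boxCox_mul γ hx hy]
  field_simp
  ring

theorem remRatio_mul (γ : ℝ) {a A : ℝ → ℝ} {t x y : ℝ} (hx : 0 < x) (hy : 0 < y)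
    (htx : a (t * x) ≠ 0) (hAx : A (t * x) ≠ 0) :
    remRatio γ a A t (x * y) = y ^ γ * remRatio γ a A t x
      + prodRatio a A t x * remRatio γ a A (t * x) y := by
  unfold remRatio prodRatio
  rw [Real.mul_rpow hx.le hy.le, ← mul_assoc]
  field_simp
  ring

theorem continuousOn_primitive_Ioi {f : ℝ → ℝ} (hf : ContinuousOn f (Ioi 0)) :
    ContinuousOn (fun x => ∫ s in (1 : ℝ)..x, f s) (Ioi 0) := by
  intro x hx
  have hx : 0 < x := hx
  have hsub : uIcc 1 x ⊆ Ioi 0 := fun s hs =>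
    lt_of_lt_of_le (lt_min one_pos hx) (by simpa [uIcc] using hs.1)
  have hi : IntervalIntegrable f volume 1 x := (hf.mono hsub).intervalIntegrable
  exact (intervalIntegral.integral_hasDerivAt_right hi
    (hf.stronglyMeasurableAtFilter isOpen_Ioi x hx)
    (hf.continuousAt (Ioi_mem_nhds hx))).continuousAt.continuousWithinAt

theorem continuousOn_rpow_Ioi (r : ℝ) : ContinuousOn (fun s : ℝ => s ^ r) (Ioi 0) := fun _ hs =>
  (Real.continuousAt_rpow_const _ _ (Or.inl (ne_of_gt hs))).continuousWithinAt

theorem Psi_integrand_continuousOn (γ ρ : ℝ) :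
    ContinuousOn (fun s : ℝ => s ^ (γ - 1) * ∫ u in (1 : ℝ)..s, u ^ (ρ - 1)) (Ioi 0) :=
  (continuousOn_rpow_Ioi _).mul (continuousOn_primitive_Ioi (continuousOn_rpow_Ioi _))

theorem Psi_continuousOn (γ ρ : ℝ) : ContinuousOn (Psi γ ρ) (Ioi 0) :=
  continuousOn_primitive_Ioi (Psi_integrand_continuousOn γ ρ)

section SecondOrder

variable {μ : Measure ℝ} {γ ρ : ℝ} {a A : ℝ → ℝ}

theorem remIncr_measurable (μ : Measure ℝ) (γ : ℝ) (a A : ℝ → ℝ) (t : ℝ) :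
    Measurable (remIncr μ γ a A t) :=
  ((incr_measurable μ a t).sub (boxCox_measurable γ)).div_const _

theorem prodRatio_localBound (ha : ∀ t : ℝ, 0 < t → 0 < a t)
    (h : ∀ x : ℝ, 0 < x → Tendsto (fun t => incr μ a t x) atTop (𝓝 (boxCox γ x)))
    (hA : IsRegularlyVarying A ρ) : LocalBound (prodRatio a A) :=
  (ratio_localBound ha h).mul hA.ratio_localBound

theorem tendsto_prodRatio (ha : ∀ t : ℝ, 0 < t → 0 < a t)
    (h : ∀ x : ℝ, 0 < x → Tendsto (fun t => incr μ a t x) atTop (𝓝 (boxCox γ x)))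
    (hA : IsRegularlyVarying A ρ) :
    Tendsto (fun t => prodRatio a A t 2) atTop (𝓝 (2 ^ (γ + ρ))) := by
  rw [Real.rpow_add two_pos]
  exact (tendsto_ratio ha h two_pos).mul (hA.tendsto_ratio 2 two_pos)

theorem prodRatio_mul (ha : ∀ t : ℝ, 0 < t → 0 < a t) (hA : IsRegularlyVarying A ρ) :
    ∀ᶠ t in atTop, ∀ x : ℝ, 1 ≤ x →
      prodRatio a A t (2 * x) = prodRatio a A t x * prodRatio a A (t * x) 2 := by
  filter_upwards [eventually_gt_atTop 0, eventually_forall_mul hA.eventually_ne] with t ht hne x hx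
  have n1 : A t ≠ 0 := by simpa using hne 1 le_rfl
  have n2 := hne _ hx
  have := ha _ (mul_pos ht (by linarith : 0 < x))
  have := ha t ht
  unfold prodRatio
  rw [mul_comm 2 x, ← mul_assoc t x 2]
  field_simp

theorem prodRatio_growthBound (ha : ∀ t : ℝ, 0 < t → 0 < a t)
    (h : ∀ x : ℝ, 0 < x → Tendsto (fun t => incr μ a t x) atTop (𝓝 (boxCox γ x)))
    (hA : IsRegularlyVarying A ρ) {κ : ℝ} (hκ : 0 ≤ κ) (hγκ : γ + ρ < κ) :
    GrowthBound (prodRatio a A) κ := by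
  refine GrowthBound.of_mul hκ ?_ (prodRatio_localBound ha h hA) (tendsto_prodRatio ha h hA)
    (prodRatio_mul ha hA)
  rw [abs_of_pos (by positivity)]
  exact Real.rpow_lt_rpow_of_exponent_lt one_lt_two hγκ

theorem prodRatio_inv_growthBound (ha : ∀ t : ℝ, 0 < t → 0 < a t)
    (h : ∀ x : ℝ, 0 < x → Tendsto (fun t => incr μ a t x) atTop (𝓝 (boxCox γ x)))
    (hA : IsRegularlyVarying A ρ) {κ : ℝ} (hκ : 0 ≤ κ) (hγκ : -(γ + ρ) < κ) :
    GrowthBound (fun t x => (prodRatio a A t x)⁻¹) κ := by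
  have hloc : LocalBound fun t x => (prodRatio a A t x)⁻¹ := by
    simp only [prodRatio, mul_inv]
    exact (ratio_inv_localBound ha h).mul hA.ratio_inv_localBound
  refine GrowthBound.of_mul hκ ?_ hloc ((tendsto_prodRatio ha h hA).inv₀ (by positivity)) ?_
  · rw [abs_of_pos (by positivity), ← Real.rpow_neg (by norm_num)]
    exact Real.rpow_lt_rpow_of_exponent_lt one_lt_two hγκ
  · filter_upwards [prodRatio_mul ha hA] with t ht x hx
    rw [ht x hx, mul_inv]

/-- For each good y, `remIncr_mul` bounds one linear form H + B·boxCox y in the unknowns H =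
`remIncr` and B = `remRatio` at w. A y in [1, 2] and one in [3, 4] give two independent forms, which
bound both unknowns. Nothing is assumed about convergence of `remRatio` or measurability of `a`. -/
theorem rem_localBounds (ha : ∀ t : ℝ, 0 < t → 0 < a t)
    (h : ∀ x : ℝ, 0 < x → Tendsto (fun t => incr μ a t x) atTop (𝓝 (boxCox γ x)))
    (hS : SecondOrderCondition μ γ a ρ A) :
    LocalBound fun t x => max |remIncr μ γ a A t x| |remRatio γ a A t x| := by
  refine localBound_of_seq fun t w ht ht0 hw => ?_
  have hw0 : ∀ n, 0 < w n := fun n => by linarith [(hw n).1]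
  have htw : Tendsto (fun n => t n * w n) atTop atTop :=
    tendsto_atTop_mono (fun n => by nlinarith [(hw n).1, ht0 n]) ht
  have hlim : ∀ x ∈ Icc (1 : ℝ) 8,
      Tendsto (fun s => remIncr μ γ a A s x) atTop (𝓝 (Psi γ ρ x)) := fun x hx =>
    hS.tendsto_quotient x (by linarith [hx.1])
  have hcont : ContinuousOn (Psi γ ρ) (Icc 1 8) :=
    (Psi_continuousOn γ ρ).mono fun x hx => lt_of_lt_of_le one_pos hx.1
  obtain ⟨C, hC⟩ := exists_good_point hw
    (fun n => (remIncr_measurable μ γ a A (t n)).aemeasurable)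
    (fun n => (remIncr_measurable μ γ a A (t n * w n)).aemeasurable)
    (fun x hx => (hlim x hx).comp ht) (fun x hx => (hlim x hx).comp htw) hcont hcont
  obtain ⟨R, hR, hr⟩ := prodRatio_localBound ha h hS.regularlyVarying
  have hd : 0 < boxCox γ 3 - boxCox γ 2 := sub_pos.mpr (boxCox_lt two_pos (by norm_num))
  have hb2 : 0 < boxCox γ 2 := boxCox_pos γ one_lt_two
  -- `D` bounds each linear form; `B` divides the difference of two forms by the least possible gap
  -- of `boxCox` between [1, 2] and [3, 4].
  set D := C + R * C with hD
  set B := 2 * D / (boxCox γ 3 - boxCox γ 2) with hB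
  refine ⟨D + B * boxCox γ 2 + B, ?_⟩
  have hne := eventually_forall_mul hS.regularlyVarying.eventually_ne
  filter_upwards [hC 1 ⟨le_rfl, by norm_num⟩, hC 3 ⟨by norm_num, le_rfl⟩, ht.eventually hne,
    ht.eventually hr] with n hn1 hn2 hne hr
  have n1 : A (t n) ≠ 0 := by simpa using hne 1 le_rfl
  have n2 : A (t n * w n) ≠ 0 := hne _ (hw n).1
  have hat := (ha _ (ht0 n)).ne'
  have hatw := (ha _ (mul_pos (ht0 n) (hw0 n))).ne'
  have hCn : 0 ≤ C := by
    obtain ⟨y, -, h1, -⟩ := hn1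
    exact (abs_nonneg _).trans h1
  have key : ∀ y, 0 < y → |remIncr μ γ a A (t n) (w n * y)| ≤ C →
      |remIncr μ γ a A (t n * w n) y| ≤ C →
      |remIncr μ γ a A (t n) (w n) + remRatio γ a A (t n) (w n) * boxCox γ y| ≤ D := by
    intro y hy h1 h2
    have e := remIncr_mul μ γ (hw0 n) hy hat hatw n1 n2
    have e' : remIncr μ γ a A (t n) (w n) + remRatio γ a A (t n) (w n) * boxCox γ y
        = remIncr μ γ a A (t n) (w n * y)
          - prodRatio a A (t n) (w n) * remIncr μ γ a A (t n * w n) y := by linarith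
    rw [e', hD]
    refine (abs_sub _ _).trans (add_le_add h1 ?_)
    rw [abs_mul]
    exact mul_le_mul (hr _ (hw n)) h2 (abs_nonneg _) hR
  obtain ⟨y₁, hy₁, h11, h12⟩ := hn1
  obtain ⟨y₂, hy₂, h21, h22⟩ := hn2
  have k1 := key y₁ (by linarith [hy₁.1]) h11 h12
  have k2 := key y₂ (by linarith [hy₂.1]) h21 h22
  set Hn := remIncr μ γ a A (t n) (w n)
  set Bn := remRatio γ a A (t n) (w n)
  have m1 : boxCox γ y₁ ≤ boxCox γ 2 :=
    boxCox_monotoneOn γ (show 0 < y₁ by linarith [hy₁.1]) (show (0 : ℝ) < 2 by norm_num)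
      (by linarith [hy₁.2])
  have m0 : 0 ≤ boxCox γ y₁ := by
    rw [← boxCox_one γ]
    exact boxCox_monotoneOn γ (show (0 : ℝ) < 1 by norm_num) (show 0 < y₁ by linarith [hy₁.1]) hy₁.1
  have m2 : boxCox γ 3 ≤ boxCox γ y₂ :=
    boxCox_monotoneOn γ (show (0 : ℝ) < 3 by norm_num) (show 0 < y₂ by linarith [hy₂.1]) hy₂.1
  have hBn : |Bn| ≤ B := by
    rw [hB, le_div_iff₀ hd]
    have e : Bn * (boxCox γ y₂ - boxCox γ y₁) =
        (Hn + Bn * boxCox γ y₂) - (Hn + Bn * boxCox γ y₁) := by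
      ring
    have h1 : |Bn| * (boxCox γ y₂ - boxCox γ y₁) ≤ 2 * D := by
      rw [← abs_of_nonneg (show 0 ≤ boxCox γ y₂ - boxCox γ y₁ by linarith), ← abs_mul, e, two_mul]
      exact (abs_sub _ _).trans (add_le_add k2 k1)
    refine le_trans ?_ h1
    exact mul_le_mul_of_nonneg_left (by linarith) (abs_nonneg _)
  have hB0 : 0 ≤ B := (abs_nonneg _).trans hBn
  have hD0 : 0 ≤ D := by positivity
  have hHn : |Hn| ≤ D + B * boxCox γ 2 := by
    have e : Hn = (Hn + Bn * boxCox γ y₁) - Bn * boxCox γ y₁ := by ring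
    rw [e]
    refine (abs_sub _ _).trans (add_le_add k1 ?_)
    rw [abs_mul, abs_of_nonneg m0]
    exact mul_le_mul hBn m1 m0 hB0
  rw [abs_of_nonneg (le_max_of_le_left (abs_nonneg _))]
  have : 0 ≤ B * boxCox γ 2 := by positivity
  exact max_le (by linarith) (by linarith)

theorem remIncr_localBound (ha : ∀ t : ℝ, 0 < t → 0 < a t)
    (h : ∀ x : ℝ, 0 < x → Tendsto (fun t => incr μ a t x) atTop (𝓝 (boxCox γ x)))
    (hS : SecondOrderCondition μ γ a ρ A) : LocalBound (remIncr μ γ a A) := by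
  obtain ⟨C, hC, hb⟩ := rem_localBounds ha h hS
  exact ⟨C, hC, hb.mono fun t ht x hx =>
    ((le_max_left _ _).trans (le_abs_self _)).trans (ht x hx)⟩

theorem remRatio_localBound (ha : ∀ t : ℝ, 0 < t → 0 < a t)
    (h : ∀ x : ℝ, 0 < x → Tendsto (fun t => incr μ a t x) atTop (𝓝 (boxCox γ x)))
    (hS : SecondOrderCondition μ γ a ρ A) : LocalBound (remRatio γ a A) := by
  obtain ⟨C, hC, hb⟩ := rem_localBounds ha h hS
  exact ⟨C, hC, hb.mono fun t ht x hx =>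
    ((le_max_right _ _).trans (le_abs_self _)).trans (ht x hx)⟩

theorem remRatio_growthBound (ha : ∀ t : ℝ, 0 < t → 0 < a t)
    (h : ∀ x : ℝ, 0 < x → Tendsto (fun t => incr μ a t x) atTop (𝓝 (boxCox γ x)))
    (hS : SecondOrderCondition μ γ a ρ A) {κ : ℝ} (hκ : 0 < κ) (hγκ : γ < κ) :
    GrowthBound (remRatio γ a A) κ := by
  obtain ⟨R, hR, hr⟩ := prodRatio_growthBound ha h hS.regularlyVarying hκ.le
    (by linarith [hS.rho_nonpos])
  have hloc := remRatio_localBound ha h hS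
  obtain ⟨C, hC, hb⟩ := id hloc
  refine GrowthBound.of_doubling (q := 2 ^ γ) (C := R * C) hκ.le (by positivity)
    (Real.rpow_lt_rpow_of_exponent_lt one_lt_two hγκ) hloc ?_
  filter_upwards [eventually_gt_atTop 0, hr, eventually_forall_mul hb,
    eventually_forall_mul hS.regularlyVarying.eventually_ne] with t ht hr hb hne x hx
  have hx0 : 0 < x := by linarith
  rw [mul_comm 2 x, remRatio_mul γ hx0 two_pos (ha _ (mul_pos ht hx0)).ne' (hne x hx)]
  refine (abs_add_le _ _).trans ?_
  rw [abs_mul, abs_mul, abs_of_pos (by positivity : (0 : ℝ) < 2 ^ γ)]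
  have := mul_le_mul (hr x hx) (hb x hx 2 ⟨one_le_two, le_rfl⟩) (abs_nonneg _) (by positivity)
  linarith

theorem remIncr_growthBound (ha : ∀ t : ℝ, 0 < t → 0 < a t)
    (h : ∀ x : ℝ, 0 < x → Tendsto (fun t => incr μ a t x) atTop (𝓝 (boxCox γ x)))
    (hS : SecondOrderCondition μ γ a ρ A) {κ : ℝ} (hκ : 0 < κ) (hγκ : γ < κ) :
    GrowthBound (remIncr μ γ a A) κ := by
  obtain ⟨R, hR, hr⟩ := prodRatio_growthBound ha h hS.regularlyVarying hκ.le
    (by linarith [hS.rho_nonpos])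
  obtain ⟨B, hB, hbr⟩ := remRatio_growthBound ha h hS hκ hγκ
  have hloc := remIncr_localBound ha h hS
  obtain ⟨C, hC, hb⟩ := id hloc
  have hb2 : 0 < boxCox γ 2 := boxCox_pos γ one_lt_two
  refine GrowthBound.of_doubling (q := 1) (C := B * boxCox γ 2 + R * C) hκ.le zero_le_one
    (Real.one_lt_rpow one_lt_two hκ) hloc ?_
  filter_upwards [eventually_gt_atTop 0, hr, eventually_forall_mul hb, hbr,
    eventually_forall_mul hS.regularlyVarying.eventually_ne] with t ht hr hb hbr hne x hx
  have hx0 : 0 < x := by linarith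
  have n1 : A t ≠ 0 := by simpa using hne 1 le_rfl
  rw [mul_comm 2 x, remIncr_mul μ γ hx0 two_pos (ha t ht).ne' (ha _ (mul_pos ht hx0)).ne' n1
    (hne x hx)]
  refine (abs_add_le _ _).trans ?_
  have h1 := abs_add_le (remIncr μ γ a A t x) (remRatio γ a A t x * boxCox γ 2)
  rw [abs_mul, abs_of_pos hb2] at h1
  rw [abs_mul]
  have h2 := mul_le_mul (hr x hx) (hb x hx 2 ⟨one_le_two, le_rfl⟩) (abs_nonneg _) (by positivity)
  have h3 := mul_le_mul_of_nonneg_right (hbr x hx) hb2.le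
  linarith

theorem SmallBound.of_tendsto {f : ℝ → ℝ → ℝ} {g : ℝ → ℝ} (hf : SmallBound f)
    (hlim : ∀ x : ℝ, 0 < x → Tendsto (fun t => f t x) atTop (𝓝 (g x))) :
    ∃ C K : ℝ, 0 ≤ C ∧ 0 ≤ K ∧ ∀ z : ℝ, 0 < z → z ≤ 1 → |g z| ≤ C * z ^ (-K) := by
  obtain ⟨C, K, hC, hK, hb⟩ := hf
  exact ⟨C, K, hC, hK, fun z hz hz1 =>
    le_of_tendsto (hlim z hz).abs (hb.mono fun t ht => ht z hz hz1)⟩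

theorem remIncr_smallBound (ha : ∀ t : ℝ, 0 < t → 0 < a t)
    (h : ∀ x : ℝ, 0 < x → Tendsto (fun t => incr μ a t x) atTop (𝓝 (boxCox γ x)))
    (hL : FiniteLeftEndpoint μ) (hS : SecondOrderCondition μ γ a ρ A) :
    SmallBound (remIncr μ γ a A) := by
  have hI := incr_smallBound ha h hL
  obtain ⟨C₅, K₅, hC₅, hK₅, h₅⟩ := hI.of_tendsto h
  obtain ⟨C₄, K₄, hC₄, hK₄, h₄⟩ := hI
  set κ := |γ| + |ρ| + 1 with hκ
  have hκ0 : 0 < κ := by positivity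
  have g1 := neg_le_abs γ
  have g2 := le_abs_self γ
  have g3 := neg_le_abs ρ
  have g4 := abs_nonneg ρ
  have g5 := abs_nonneg γ
  obtain ⟨C₁, hC₁, h₁⟩ := prodRatio_inv_growthBound ha h hS.regularlyVarying hκ0.le (by linarith)
  obtain ⟨C₂, hC₂, h₂⟩ := remIncr_growthBound ha h hS hκ0 (by linarith)
  obtain ⟨C₃, hC₃, h₃⟩ := remRatio_growthBound ha h hS hκ0 (by linarith)
  obtain ⟨C₆, hC₆, h₆⟩ := hS.regularlyVarying.ratio_inv_growthBound hκ0.le (by linarith)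
  obtain ⟨t₀, h₀⟩ := eventually_atTop.mp (((h₁.and h₂).and (h₃.and h₆)).and
    ((eventually_gt_atTop 0).and hS.regularlyVarying.eventually_ne))
  have ht₀ : 0 < t₀ := (h₀ t₀ le_rfl).2.1
  have hA₀ : 0 < |A t₀| := abs_pos.mpr (h₀ t₀ le_rfl).2.2
  set E := C₁ * (C₂ + C₃ * C₅) + (C₄ + C₅) * (C₆ / |A t₀|) with hE
  set K := κ + κ + K₄ + K₅ with hK
  refine ⟨E, K, by positivity, by positivity, ?_⟩
  filter_upwards [eventually_ge_atTop t₀, h₄] with t htt h₄ z hz hz1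
  have ht : 0 < t := ht₀.trans_le htt
  have hx1 : 1 ≤ z⁻¹ := (one_le_inv₀ hz).mpr hz1
  have hpow : ∀ r : ℝ, z ^ (-r) = (z⁻¹) ^ r := fun r => by
    rw [Real.inv_rpow hz.le, Real.rpow_neg hz.le]
  have h₄ := h₄ z hz hz1
  have h₅ := h₅ z hz hz1
  rw [hpow] at h₄ h₅ ⊢
  set x := z⁻¹ with hx
  have hx0 : 0 < x := one_pos.trans_le hx1
  have mono : ∀ {r s : ℝ}, r ≤ s → x ^ r ≤ x ^ s := fun h => Real.rpow_le_rpow_of_exponent_le hx1 h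
  -- As in `incr_smallBound`. When tz is small no cancellation is needed: both terms of the
  -- remainder are bounded separately, and 1/|A(t)| is at most a power of t/t₀ < 1/z.
  rcases le_or_gt t₀ (t * z) with hc | hc
  · have hs := h₀ (t * z) hc
    have hst : t * z * x = t := mul_inv_cancel_right₀ hz.ne' t
    have has := ha _ hs.2.1
    have hat := ha t ht
    have hAt := (h₀ t htt).2.2
    have e := remIncr_mul μ γ (a := a) (A := A) (t := t * z) hx0 hz has.ne'
      (by rw [hst]; exact hat.ne') hs.2.2 (by rw [hst]; exact hAt)
    rw [hx, inv_mul_cancel₀ hz.ne', ← hx, hst] at e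
    have e0 : remIncr μ γ a A (t * z) 1 = 0 := by simp [remIncr, incr_one, boxCox_one]
    rw [e0] at e
    have hr : prodRatio a A (t * z) x ≠ 0 := by
      unfold prodRatio
      rw [hst]
      exact mul_ne_zero (div_pos hat has).ne' (div_ne_zero hAt hs.2.2)
    have b1 := hs.1.1.1 x hx1
    have b2 := hs.1.1.2 x hx1
    have b3 := hs.1.2.1 x hx1
    beta_reduce at b1
    have e1 : remIncr μ γ a A t z = -((prodRatio a A (t * z) x)⁻¹ *
        (remIncr μ γ a A (t * z) x + remRatio γ a A (t * z) x * boxCox γ z)) := by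
      rw [eq_neg_iff_add_eq_zero]
      calc _ = (prodRatio a A (t * z) x)⁻¹ * (remIncr μ γ a A (t * z) x
            + remRatio γ a A (t * z) x * boxCox γ z
            + prodRatio a A (t * z) x * remIncr μ γ a A t z) := by
            rw [mul_add _ _ (prodRatio a A (t * z) x * remIncr μ γ a A t z),
              inv_mul_cancel_left₀ hr]; ring
        _ = 0 := by rw [← e, mul_zero]
    have b4 : |remIncr μ γ a A (t * z) x + remRatio γ a A (t * z) x * boxCox γ z|
        ≤ (C₂ + C₃ * C₅) * x ^ (κ + K₅) := by
      refine (abs_add_le _ _).trans ?_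
      rw [abs_mul, add_mul]
      refine add_le_add (b2.trans ?_) ?_
      · exact mul_le_mul_of_nonneg_left (mono (by linarith)) hC₂
      · rw [Real.rpow_add hx0]
        calc _ ≤ (C₃ * x ^ κ) * (C₅ * x ^ K₅) := mul_le_mul b3 h₅ (abs_nonneg _) (by positivity)
          _ = _ := by ring
    rw [e1, abs_neg, abs_mul]
    calc _ ≤ (C₁ * x ^ κ) * ((C₂ + C₃ * C₅) * x ^ (κ + K₅)) :=
          mul_le_mul b1 b4 (abs_nonneg _) (by positivity)
      _ = C₁ * (C₂ + C₃ * C₅) * x ^ (κ + (κ + K₅)) := by rw [Real.rpow_add hx0 κ (κ + K₅)]; ring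
      _ ≤ E * x ^ K := by
          refine mul_le_mul ?_ (mono (by linarith)) (by positivity) (by positivity)
          have : 0 ≤ (C₄ + C₅) * (C₆ / |A t₀|) := by positivity
          linarith
  · have hx2 : 1 ≤ t / t₀ := (one_le_div ht₀).mpr htt
    have hx0z : t / t₀ ≤ x := by
      rw [div_le_iff₀ ht₀, hx, ← div_eq_inv_mul, le_div_iff₀ hz]; exact hc.le
    have hte : t₀ * (t / t₀) = t := mul_div_cancel₀ _ ht₀.ne'
    have b1 := (h₀ t₀ le_rfl).1.2.2 (t / t₀) hx2
    beta_reduce at b1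
    rw [hte, inv_div, abs_div] at b1
    have hAt := abs_pos.mpr (h₀ t htt).2.2
    have b3 : (t / t₀) ^ κ ≤ x ^ κ := Real.rpow_le_rpow (by positivity) hx0z hκ0.le
    have b4 : |A t|⁻¹ ≤ C₆ / |A t₀| * x ^ κ := by
      have : |A t|⁻¹ = (|A t₀| / |A t|) / |A t₀| := by field_simp
      rw [this, div_mul_eq_mul_div]
      gcongr
      exact b1.trans (by gcongr)
    have b5 : |incr μ a t z - boxCox γ z| ≤ (C₄ + C₅) * x ^ (K₄ + K₅) := by
      refine (abs_sub _ _).trans ?_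
      rw [add_mul]
      exact add_le_add
        (h₄.trans (mul_le_mul_of_nonneg_left (mono (by linarith)) hC₄))
        (h₅.trans (mul_le_mul_of_nonneg_left (mono (by linarith)) hC₅))
    rw [remIncr, abs_div, div_eq_mul_inv]
    calc _ ≤ ((C₄ + C₅) * x ^ (K₄ + K₅)) * (C₆ / |A t₀| * x ^ κ) :=
          mul_le_mul b5 b4 (by positivity) (by positivity)
      _ = (C₄ + C₅) * (C₆ / |A t₀|) * x ^ (K₄ + K₅ + κ) := by
          rw [Real.rpow_add hx0 (K₄ + K₅)]; ring
      _ ≤ E * x ^ K := by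
          refine mul_le_mul ?_ (mono (by linarith)) (by positivity) (by positivity)
          have : 0 ≤ C₁ * (C₂ + C₃ * C₅) := by positivity
          linarith

end SecondOrder

/-! ### The limit function -/

theorem Psi_nonneg (γ ρ : ℝ) {x : ℝ} (hx : 0 < x) : 0 ≤ Psi γ ρ x := by
  rcases le_total 1 x with h | h
  · refine intervalIntegral.integral_nonneg h fun s hs => ?_
    have hs0 : 0 < s := by linarith [hs.1]
    refine mul_nonneg (by positivity) (intervalIntegral.integral_nonneg hs.1 fun u hu => ?_)
    exact Real.rpow_nonneg (by linarith [hu.1]) _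
  -- For x ≤ 1 both the outer and the inner integral reverse orientation, and the signs cancel.
  · rw [Psi, intervalIntegral.integral_symm, ← intervalIntegral.integral_neg]
    refine intervalIntegral.integral_nonneg h fun s hs => ?_
    have hs0 : 0 < s := hx.trans_le hs.1
    rw [intervalIntegral.integral_symm, mul_neg, neg_neg]
    refine mul_nonneg (by positivity) (intervalIntegral.integral_nonneg hs.2 fun u hu => ?_)
    exact Real.rpow_nonneg (by linarith [hu.1]) _

theorem integral_pos_of_continuousOn_Ioi {f : ℝ → ℝ} (hf : ContinuousOn f (Ioi 0))
    (hpos : ∀ s, 1 < s → 0 < f s) {x : ℝ} (hx : 1 < x) : 0 < ∫ s in (1 : ℝ)..x, f s := by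
  refine intervalIntegral.intervalIntegral_pos_of_pos_on ?_ (fun s hs => hpos s hs.1) hx
  refine (hf.mono fun s hs => ?_).intervalIntegrable
  rw [uIcc_of_le hx.le] at hs
  exact one_pos.trans_le hs.1

theorem Psi_pos (γ ρ : ℝ) {x : ℝ} (hx : 1 < x) : 0 < Psi γ ρ x := by
  refine integral_pos_of_continuousOn_Ioi (Psi_integrand_continuousOn γ ρ) (fun s hs => ?_) hx
  have hs0 : 0 < s := one_pos.trans hs
  refine mul_pos (by positivity) (integral_pos_of_continuousOn_Ioi (continuousOn_rpow_Ioi _)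
    (fun u hu => ?_) hs)
  have hu0 : 0 < u := one_pos.trans hu
  positivity

/-! ### Dominated convergence -/

/-- The substitution z ↦ 1/z turns this into the Gamma integral at 1 - r > 0. -/
theorem integrableOn_rpow_mul_frechet {r : ℝ} (hr : r < 1) :
    IntegrableOn (fun z : ℝ => z ^ r * (Real.exp (-1 / z) / z ^ 2)) (Ioi 0) := by
  have h := (integrableOn_Ioi_comp_rpow_iff' _ (show (-1 : ℝ) ≠ 0 by norm_num)).mpr
    (Real.GammaIntegral_convergent (show 0 < 1 - r by linarith))
  refine h.congr_fun (fun z hz => ?_) measurableSet_Ioi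
  have hz : 0 < z := hz
  have e1 : z ^ (-1 - 1 : ℝ) = (z ^ 2)⁻¹ := by
    rw [show (-1 - 1 : ℝ) = -((2 : ℕ) : ℝ) by norm_num, Real.rpow_neg hz.le, Real.rpow_natCast]
  have e2 : (z ^ (-1 : ℝ)) ^ (1 - r - 1) = z ^ r := by
    rw [← Real.rpow_mul hz.le]; congr 1; ring
  simp only [smul_eq_mul]
  rw [e1, e2, Real.rpow_neg_one, neg_div, one_div]
  field_simp

theorem exists_integrable_bound {f : ℝ → ℝ → ℝ} {p κ : ℝ} (hp : 1 ≤ p) (hpκ : p * κ < 1)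
    (hG : GrowthBound f κ) (hS : SmallBound f) :
    ∃ b : ℝ → ℝ, IntegrableOn b (Ioi 0) ∧ ∀ᶠ t in atTop, ∀ z ∈ Ioi (0 : ℝ),
      |f t z| ^ p * (Real.exp (-1 / z) / z ^ 2) ≤ b z := by
  obtain ⟨C, hC, hG⟩ := hG
  obtain ⟨D, K, hD, hK, hS⟩ := hS
  have hp0 : 0 < p := by linarith
  refine ⟨fun z => D ^ p * (z ^ (-K * p) * (Real.exp (-1 / z) / z ^ 2))
    + C ^ p * (z ^ (κ * p) * (Real.exp (-1 / z) / z ^ 2)), ?_, ?_⟩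
  · refine Integrable.add (Integrable.const_mul (integrableOn_rpow_mul_frechet ?_) _)
      (Integrable.const_mul (integrableOn_rpow_mul_frechet ?_) _)
    · nlinarith
    · linarith
  · filter_upwards [hG, hS] with t hG hS z hz
    have hz : 0 < z := hz
    have hw : 0 ≤ Real.exp (-1 / z) / z ^ 2 := by positivity
    have key : ∀ {B r : ℝ}, 0 ≤ B → |f t z| ≤ B * z ^ r →
        |f t z| ^ p * (Real.exp (-1 / z) / z ^ 2)
          ≤ B ^ p * (z ^ (r * p) * (Real.exp (-1 / z) / z ^ 2)) := by
      intro B r hB h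
      have h1 := Real.rpow_le_rpow (abs_nonneg _) h hp0.le
      rw [Real.mul_rpow hB (by positivity), ← Real.rpow_mul hz.le] at h1
      rw [← mul_assoc]
      exact mul_le_mul_of_nonneg_right h1 hw
    have hn1 : 0 ≤ D ^ p * (z ^ (-K * p) * (Real.exp (-1 / z) / z ^ 2)) := by positivity
    have hn2 : 0 ≤ C ^ p * (z ^ (κ * p) * (Real.exp (-1 / z) / z ^ 2)) := by positivity
    rcases le_total z 1 with h | h
    · linarith [key hD (hS z hz h)]
    · linarith [key hC (hG z h)]

theorem tendsto_lintegral_abs_rpow {f : ℝ → ℝ → ℝ} {g : ℝ → ℝ} {p κ : ℝ} (hp : 1 ≤ p)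
    (hpκ : p * κ < 1) (hG : GrowthBound f κ) (hS : SmallBound f) (hm : ∀ t, Measurable (f t))
    (hlim : ∀ z : ℝ, 0 < z → Tendsto (fun t => f t z) atTop (𝓝 (g z))) :
    IntegrableOn (fun z => |g z| ^ p * (Real.exp (-1 / z) / z ^ 2)) (Ioi 0) ∧
    Tendsto (fun t => ∫⁻ z in Ioi (0 : ℝ),
        ENNReal.ofReal (|f t z| ^ p * (Real.exp (-1 / z) / z ^ 2))) atTop
      (𝓝 (ENNReal.ofReal (∫ z in Ioi (0 : ℝ), |g z| ^ p * (Real.exp (-1 / z) / z ^ 2)))) := by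
  obtain ⟨b, hb, hfb⟩ := exists_integrable_bound hp hpκ hG hS
  have hp0 : 0 ≤ p := by linarith
  have hlim' : ∀ z ∈ Ioi (0 : ℝ), Tendsto (fun t => |f t z| ^ p * (Real.exp (-1 / z) / z ^ 2))
      atTop (𝓝 (|g z| ^ p * (Real.exp (-1 / z) / z ^ 2))) := fun z hz =>
    ((hlim z hz).abs.rpow_const (Or.inr hp0)).mul_const _
  have hgb : ∀ z ∈ Ioi (0 : ℝ), |g z| ^ p * (Real.exp (-1 / z) / z ^ 2) ≤ b z := fun z hz =>
    le_of_tendsto (hlim' z hz) (hfb.mono fun t ht => ht z hz)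
  have hgm : AEMeasurable g (volume.restrict (Ioi 0)) :=
    aemeasurable_of_tendsto_metrizable_ae atTop (fun t => (hm t).aemeasurable)
      ((ae_restrict_iff' measurableSet_Ioi).mpr (ae_of_all _ hlim))
  have hgn : ∀ z, 0 ≤ |g z| ^ p * (Real.exp (-1 / z) / z ^ 2) := fun z => by positivity
  have hint : IntegrableOn (fun z => |g z| ^ p * (Real.exp (-1 / z) / z ^ 2)) (Ioi 0) := by
    refine Integrable.mono' hb (AEMeasurable.aestronglyMeasurable (by fun_prop)) ?_
    refine (ae_restrict_iff' measurableSet_Ioi).mpr (ae_of_all _ fun z hz => ?_)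
    rw [Real.norm_of_nonneg (hgn z)]
    exact hgb z hz
  refine ⟨hint, ?_⟩
  rw [ofReal_integral_eq_lintegral_ofReal hint (ae_of_all _ hgn)]
  refine tendsto_lintegral_filter_of_dominated_convergence (fun z => ENNReal.ofReal (b z))
    (Eventually.of_forall fun t => ?_) ?_ ?_ ?_
  · have := hm t
    fun_prop
  · filter_upwards [hfb] with t ht
    exact (ae_restrict_iff' measurableSet_Ioi).mpr
      (ae_of_all _ fun z hz => ENNReal.ofReal_le_ofReal (ht z hz))
  · exact (hb.lintegral_lt_top).ne
  · exact (ae_restrict_iff' measurableSet_Ioi).mpr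
      (ae_of_all _ fun z hz => ENNReal.tendsto_ofReal (hlim' z hz))

/-! ### Asymptotics of A''_p -/

section Rates

variable {μ : Measure ℝ} {γ ρ p : ℝ} {a A : ℝ → ℝ}

theorem exists_growth_exponent (hp : 1 ≤ p) (hpγ : p * max γ 0 < 1) :
    ∃ κ, 0 < κ ∧ γ < κ ∧ p * κ < 1 := by
  have hp0 : 0 < p := by linarith
  have : max γ 0 < 1 / p := by rwa [lt_div_iff₀ hp0, mul_comm]
  obtain ⟨κ, h1, h2⟩ := exists_between this
  rw [lt_div_iff₀ hp0, mul_comm] at h2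
  exact ⟨κ, (le_max_right _ _).trans_lt h1, (le_max_left _ _).trans_lt h1, h2⟩

theorem tendsto_approxRate_zero (hp : 1 ≤ p) (hpγ : p * max γ 0 < 1)
    (ha : ∀ t : ℝ, 0 < t → 0 < a t) (hL : FiniteLeftEndpoint μ)
    (hF : FirstOrderCondition μ γ a) :
    Tendsto (approxRate μ γ a p) atTop (𝓝 0) := by
  have hp0 : 0 < p := by linarith
  obtain ⟨κ, hκ, hγκ, hpκ⟩ := exists_growth_exponent hp hpγ
  have h : ∀ x : ℝ, 0 < x → Tendsto (fun t => incr μ a t x) atTop (𝓝 (boxCox γ x)) :=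
    fun x hx => tendsto_incr ha hF hx
  have hG : GrowthBound (fun t x => incr μ a t x - boxCox γ x) κ := by
    obtain ⟨C, hC, hb⟩ := incr_growthBound ha h hκ hγκ
    refine ⟨C + C, by positivity, hb.mono fun t ht x hx => ?_⟩
    have := le_of_tendsto (h x (by linarith)).abs (hb.mono fun t ht => ht x hx)
    rw [add_mul]
    exact (abs_sub _ _).trans (add_le_add (ht x hx) this)
  have hS : SmallBound (fun t x => incr μ a t x - boxCox γ x) := by
    obtain ⟨C, K, hC, hK, hb⟩ := incr_smallBound ha h hL
    refine ⟨C + C, K, by positivity, hK, hb.mono fun t ht x hx hx1 => ?_⟩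
    have := le_of_tendsto (h x hx).abs (hb.mono fun t ht => ht x hx hx1)
    rw [add_mul]
    exact (abs_sub _ _).trans (add_le_add (ht x hx hx1) this)
  have := (tendsto_lintegral_abs_rpow (g := fun _ => 0) hp hpκ hG hS
    (fun t => (incr_measurable μ a t).sub (boxCox_measurable γ))
    (fun z hz => by simpa using (h z hz).sub_const (boxCox γ z))).2
  simp only [abs_zero, Real.zero_rpow hp0.ne', zero_mul, integral_zero, ENNReal.ofReal_zero] at this
  have h2 := this.ennrpow_const (1 / p)
  rw [ENNReal.zero_rpow_of_pos (by positivity)] at h2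
  exact h2

/-- The identity lives in [0, ∞], so finiteness of the rate is deduced from it rather than
presupposed. -/
theorem approxRate_eq_mul (hp : 1 ≤ p) {t : ℝ} (hA : A t ≠ 0) :
    approxRate μ γ a p t = ENNReal.ofReal |A t| * (∫⁻ z in Ioi (0 : ℝ), ENNReal.ofReal
      (|remIncr μ γ a A t z| ^ p * (Real.exp (-1 / z) / z ^ 2))) ^ (1 / p) := by
  have hp0 : 0 < p := by linarith
  have hm := remIncr_measurable μ γ a A t
  have e : ENNReal.ofReal |A t| = (ENNReal.ofReal |A t| ^ p) ^ (1 / p) := by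
    rw [← ENNReal.rpow_mul, mul_one_div_cancel hp0.ne', ENNReal.rpow_one]
  rw [e, ← ENNReal.mul_rpow_of_nonneg _ _ (by positivity), ← lintegral_const_mul _ (by fun_prop)]
  unfold approxRate
  congr 1
  refine lintegral_congr fun z => ?_
  rw [ENNReal.ofReal_rpow_of_nonneg (abs_nonneg _) hp0.le,
    ← ENNReal.ofReal_mul (by positivity), ← mul_assoc,
    ← Real.mul_rpow (abs_nonneg _) (abs_nonneg _), ← abs_mul, remIncr, mul_div_cancel₀ _ hA]
  rfl

theorem second_order_rate (hp : 1 ≤ p) (hpγ : p * max γ 0 < 1)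
    (ha : ∀ t : ℝ, 0 < t → 0 < a t) (hL : FiniteLeftEndpoint μ)
    (hF : FirstOrderCondition μ γ a) (hS : SecondOrderCondition μ γ a ρ A) :
    IntegrableOn (limitIntegrand γ ρ p) (Ioi 0) ∧ (∀ᶠ t in atTop, approxRate μ γ a p t ≠ ∞) ∧
      (fun t => (approxRate μ γ a p t).toReal) ~[atTop] fun t => limitConst γ ρ p * |A t| := by
  have hp0 : 0 < p := by linarith
  obtain ⟨κ, hκ, hγκ, hpκ⟩ := exists_growth_exponent hp hpγ
  have h : ∀ x : ℝ, 0 < x → Tendsto (fun t => incr μ a t x) atTop (𝓝 (boxCox γ x)) :=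
    fun x hx => tendsto_incr ha hF hx
  obtain ⟨hint, hlim⟩ := tendsto_lintegral_abs_rpow hp hpκ (remIncr_growthBound ha h hS hκ hγκ)
    (remIncr_smallBound ha h hL hS) (remIncr_measurable μ γ a A) hS.tendsto_quotient
  have heq : EqOn (fun z => |Psi γ ρ z| ^ p * (Real.exp (-1 / z) / z ^ 2)) (limitIntegrand γ ρ p)
      (Ioi 0) := fun z hz => by
    simp only [limitIntegrand, abs_of_nonneg (Psi_nonneg γ ρ hz)]
  have hint' : IntegrableOn (limitIntegrand γ ρ p) (Ioi 0) :=
    hint.congr_fun heq measurableSet_Ioi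
  rw [setIntegral_congr_fun measurableSet_Ioi heq] at hlim
  have hnn : ∀ z ∈ Ioi (0 : ℝ), 0 ≤ limitIntegrand γ ρ p z := fun z hz => by
    have := Psi_nonneg γ ρ hz
    unfold limitIntegrand
    positivity
  have hI0 : 0 ≤ ∫ z in Ioi (0 : ℝ), limitIntegrand γ ρ p z :=
    setIntegral_nonneg measurableSet_Ioi hnn
  -- Strict positivity, from Ψ > 0 on (1, ∞), is needed because convergence to a constant is
  -- asymptotic equivalence only when the constant is nonzero.
  have hI : 0 < ∫ z in Ioi (0 : ℝ), limitIntegrand γ ρ p z := by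
    rw [setIntegral_pos_iff_support_of_nonneg_ae
      ((ae_restrict_iff' measurableSet_Ioi).mpr (ae_of_all _ hnn)) hint']
    have hsub : Ioi (1 : ℝ) ⊆ Function.support (limitIntegrand γ ρ p) ∩ Ioi 0 := fun z hz => by
      have hz0 : 0 < z := one_pos.trans hz
      have := Psi_pos γ ρ hz
      refine ⟨ne_of_gt ?_, hz0⟩
      unfold limitIntegrand
      positivity
    exact lt_of_lt_of_le (by simp) (measure_mono hsub)
  have hc : 0 < limitConst γ ρ p := Real.rpow_pos_of_pos hI _
  have hJ := hlim.ennrpow_const (1 / p)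
  rw [ENNReal.ofReal_rpow_of_nonneg hI0 (by positivity)] at hJ
  change Tendsto _ _ (𝓝 (ENNReal.ofReal (limitConst γ ρ p))) at hJ
  have hne := hS.regularlyVarying.eventually_ne
  refine ⟨hint', ?_, ?_⟩
  · filter_upwards [hne, hJ.eventually_lt_const ENNReal.ofReal_lt_top] with t ht hfin
    rw [approxRate_eq_mul hp ht]
    exact ENNReal.mul_ne_top ENNReal.ofReal_ne_top hfin.ne
  · have hJr := (ENNReal.tendsto_toReal ENNReal.ofReal_ne_top).comp hJ
    rw [ENNReal.toReal_ofReal hc.le] at hJr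
    have hequiv := ((isEquivalent_const_iff_tendsto hc.ne').mpr hJr).mul
      (IsEquivalent.refl (u := fun t => |A t|) (l := atTop))
    refine hequiv.congr_left ?_
    filter_upwards [hne] with t ht
    rw [approxRate_eq_mul hp ht, ENNReal.toReal_mul, ENNReal.toReal_ofReal (abs_nonneg _)]
    exact mul_comm _ _

end Rates

end BlockMaxima

end

/-! ### The theorem, along block sizes m(n) -/

open BlockMaxima in
theorem mainTheorem9 {γ p : ℝ} (hγ : γ < 1) (hp : 1 ≤ p) (hpγ : p * max γ 0 < 1)
    (μ : Measure ℝ) [IsProbabilityMeasure μ] (a : ℝ → ℝ) (ha : ∀ t : ℝ, 0 < t → 0 < a t)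
    {Ω : Type*} [MeasurableSpace Ω] (P : Measure Ω) [IsProbabilityMeasure P]
    (X : ℕ → Ω → ℝ) (hXlaw : ∀ j, HasLaw (X j) μ P) (hXind : iIndepFun X P)
    {Ω' : Type*} [MeasurableSpace Ω'] (P' : Measure Ω') [IsProbabilityMeasure P']
    (Y : ℕ → Ω' → ℝ) (hYlaw : ∀ i, HasLaw (Y i) (gev γ) P') (hYind : iIndepFun Y P') :
    (∀ m : ℕ, 1 ≤ m →
      wasserstein p (P.map fun ω => normBlockMax μ a m (fun j => X j ω) 0) (gev γ)
        = approxRate μ γ a p m) ∧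
    (∀ n m : ℕ, 1 ≤ m → m ≤ n →
      wasserstein₂ p (lawEmpiricalMaxima P X μ a n m) (lawEmpirical P' Y (n / m))
        = approxRate μ γ a p m) ∧
    (FiniteLeftEndpoint μ → FirstOrderCondition μ γ a →
      (∀ m : ℕ → ℕ, Tendsto m atTop atTop → (∀ᶠ n in atTop, m n ≤ n) →
        Tendsto (fun n => wasserstein₂ p (lawEmpiricalMaxima P X μ a n (m n))
          (lawEmpirical P' Y (n / m n))) atTop (𝓝 0)) ∧
      ∀ (ρ : ℝ) (A : ℝ → ℝ), SecondOrderCondition μ γ a ρ A →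
        IntegrableOn (limitIntegrand γ ρ p) (Ioi 0) ∧
        ∀ m : ℕ → ℕ, Tendsto m atTop atTop → (∀ᶠ n in atTop, m n ≤ n) →
          (∀ᶠ n in atTop, wasserstein₂ p (lawEmpiricalMaxima P X μ a n (m n))
            (lawEmpirical P' Y (n / m n)) ≠ ∞) ∧
          (fun n => (wasserstein₂ p (lawEmpiricalMaxima P X μ a n (m n))
            (lawEmpirical P' Y (n / m n))).toReal)
            ~[atTop] fun n => limitConst γ ρ p * |A (m n)|) := by
  have haN : ∀ m : ℕ, 1 ≤ m → 0 < a m := fun m hm => ha m (by exact_mod_cast hm)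
  have hW : ∀ n m : ℕ, 1 ≤ m → m ≤ n →
      wasserstein₂ p (lawEmpiricalMaxima P X μ a n m) (lawEmpirical P' Y (n / m))
        = approxRate μ γ a p m := fun n m hm hmn =>
    wasserstein₂_eq_approxRate hp hXlaw hXind hYlaw hYind hm hmn (haN m hm)
  have hWev : ∀ m : ℕ → ℕ, Tendsto m atTop atTop → (∀ᶠ n in atTop, m n ≤ n) →
      (fun n => approxRate μ γ a p (m n)) =ᶠ[atTop] fun n =>
        wasserstein₂ p (lawEmpiricalMaxima P X μ a n (m n)) (lawEmpirical P' Y (n / m n)) := by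
    intro m hm hmn
    filter_upwards [hm.eventually_ge_atTop 1, hmn] with n h1 h2 using (hW n (m n) h1 h2).symm
  have hreal : ∀ m : ℕ → ℕ, Tendsto m atTop atTop →
      Tendsto (fun n => (m n : ℝ)) atTop atTop := fun m hm =>
    tendsto_natCast_atTop_atTop.comp hm
  refine ⟨fun m hm => wasserstein_eq_approxRate hp γ hXlaw hXind hm (haN m hm), hW,
    fun hL hF => ⟨fun m hm hmn => ?_, fun ρ A hS => ?_⟩⟩
  · exact ((tendsto_approxRate_zero hp hpγ ha hL hF).comp (hreal m hm)).congr' (hWev m hm hmn)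
  · obtain ⟨hint, hfin, hequiv⟩ := second_order_rate hp hpγ ha hL hF hS
    refine ⟨hint, fun m hm hmn => ⟨?_, ?_⟩⟩
    · filter_upwards [(hreal m hm).eventually hfin, hWev m hm hmn] with n h1 h2
      rw [← h2]
      exact h1
    · refine (hequiv.comp_tendsto (hreal m hm)).congr_left ?_
      filter_upwards [hWev m hm hmn] with n hn
      exact congrArg ENNReal.toReal hn
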